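/- Let $d\in\{1,2\}$, $q\in\mathbb N$ and $\Omega=\{1,\dots,q\}^{\mathbb Z^d}$ with the product topology. For $x\in\mathbb Z^d$, $\eta\in\Omega$ and $i\in\{1,\dots,q\}$ let $c_x(\eta,i)$ be the rate at which the spin at $x$ jumps to $i$ in the configuration $\eta$, and let $\eta^{x,i}$ be the configuration that equals $i$ at $x$ and $\eta$ elsewhere. For $f:\Omega\to\mathbb R$ write $\delta_y f=\sup\{|f(\eta)-f(\xi)| : \eta_z=\xi_z \text{ for all } z\neq y\}$. Assume: (R1) $\sup_x\sum_i\|c_x(\cdot,i)\|_\infty<\infty$; (R2) $\eta\mapsto c_x(\eta,i)$ is continuous for all $x$ and $i$; (R3) $\inf_{x,\eta,i}c_x(\eta,i)>0$; (R4) $\sum_{y\in\mathbb Z^d}|y|\,\sup_{x\in\mathbb Z^d}\sum_{i}\delta_{x+y}\big(\tilde c_x(\cdot,i)\big)<\infty$, where $\tilde c_x(\eta,i)=c_x(\eta,i)$ if $i\ne\eta_x$ and $\tilde c_x(\eta,i)=0$ if $i=\eta_x$. Let $(P_t)_{t\ge0}$ be the Markov semigroup on $C(\Omega)$ whose generator is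 the closure of $$\mathscr Lf(\eta)=\sum_{x}\sum_{i}c_x(\eta,i)\big[f(\eta^{x,i})-f(\eta)\big]$$ on the continuous functions $f$ with $\sum_x\delta_xf<\infty$. For a probability measure $\nu$ on $\Omega$ let $\nu P_t$ be the probability measure with $\int f\,d(\nu P_t)=\int P_tf\,d\nu$ for all $f\in C(\Omega)$, and put $$\mathscr S=\{\nu:\nu P_s=\nu\text{ for all }s\ge0\},\qquad \mathscr O=\{\nu:\nu P_T=\nu\text{ for some }T>0\}.$$ If some product measure $\mu$ (with marginals that may depend on the site) belongs to $\mathscr S$, then $\mathscr O=\mathscr S=\{\mu\}$. -/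

import Mathlib

open MeasureTheory Filter Topology
open scoped ENNReal NNReal

noncomputable section

namespace IPS

/-- The lattice `ℤ^d`; its norm `‖·‖` is the maximum norm. -/
abbrev Site (d : ℕ) : Type := Fin d → ℤ

/-- Configurations, with the product topology and its Borel sigma-algebra. -/
abbrev Config (d q : ℕ) : Type := Site d → Fin q

variable {d q : ℕ}

/-- Single-site rates: `c x η i` is the rate at which the spin at `x` jumps to `i`
when the configuration is `η`. -/
abbrev Rates (d q : ℕ) : Type := Site d → Config d q → Fin q → ℝ

/-- The oscillation at the site `y` of a function on the configuration space, with values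
in `[0, ∞]`. -/
def osc (y : Site d) (f : Config d q → ℝ) : ℝ≥0∞ :=
  ⨆ (η : Config d q) (ξ : Config d q) (_ : ∀ z, z ≠ y → η z = ξ z), ‖f η - f ξ‖ₑ

/-- The rate of a genuine jump of the spin at `x` to the value `i`. The number `c x η (η x)` has
no influence on the dynamics and is replaced by zero. -/
def jumpRate (c : Rates d q) (x : Site d) (i : Fin q) (η : Config d q) : ℝ :=
  if η x = i then 0 else c x η i

/-- The four conditions on the rates. -/
structure RateConditions (c : Rates d q) : Prop where
  /-- The rates are uniformly bounded. -/
  bounded : ⨆ x : Site d, ∑ i : Fin q, ⨆ η : Config d q, ‖c x η i‖ₑ < ⊤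
  /-- Each rate is continuous in the configuration. -/
  continuous : ∀ (x : Site d) (i : Fin q), Continuous fun η : Config d q => c x η i
  /-- The rates are bounded away from zero. -/
  bounded_below : ∃ κ : ℝ, 0 < κ ∧ ∀ (x : Site d) (η : Config d q) (i : Fin q), κ ≤ c x η i
  /-- The rates are short-range. -/
  short_range :
    ∑' y : Site d, ‖y‖ₑ * ⨆ x : Site d, ∑ i : Fin q, osc (x + y) (jumpRate c x i) < ⊤

/-- The graph of the operator `f ↦ ∑ x, ∑ i, c x η i * (f (η^{x,i}) - f η)` on the continuous
functions of finite total oscillation. -/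
def pregeneratorGraph (c : Rates d q) : Set (C(Config d q, ℝ) × C(Config d q, ℝ)) :=
  {p | ∑' x : Site d, osc x p.1 < ⊤ ∧
    ∀ η : Config d q,
      HasSum (fun x : Site d => ∑ i : Fin q, c x η i * (p.1 (Function.update η x i) - p.1 η))
        (p.2 η)}

/-- Markov (Feller) semigroups on the continuous functions. -/
structure IsMarkovSemigroup (P : ℝ≥0 → C(Config d q, ℝ) →L[ℝ] C(Config d q, ℝ)) : Prop where
  zero : ∀ f, P 0 f = f
  add : ∀ s t f, P (s + t) f = P s (P t f)
  one : ∀ t, P t 1 = 1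
  nonneg : ∀ t f, 0 ≤ f → 0 ≤ P t f
  continuous : ∀ f, Continuous fun t => P t f

/-- The graph of the infinitesimal generator of `P`: all pairs `(f, g)` such that
`(P t f - f) / t` converges uniformly to `g` as `t ↓ 0`. -/
def generatorGraph (P : ℝ≥0 → C(Config d q, ℝ) →L[ℝ] C(Config d q, ℝ)) :
    Set (C(Config d q, ℝ) × C(Config d q, ℝ)) :=
  {p | Tendsto (fun t : ℝ≥0 => (t : ℝ)⁻¹ • (P t p.1 - p.1)) (𝓝[>] 0) (𝓝 p.2)}

/-- `P` is the Markov semigroup of the interacting particle system with rates `c`: its generator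
is the closure of the operator given by the rates on functions of finite total oscillation. -/
structure IsSemigroupOf (c : Rates d q)
    (P : ℝ≥0 → C(Config d q, ℝ) →L[ℝ] C(Config d q, ℝ)) : Prop where
  markov : IsMarkovSemigroup P
  generator_eq : generatorGraph P = closure (pregeneratorGraph c)

/-- `ρ = ν P_t`, that is, `ρ` is the law at time `t` of the process started from `ν`. -/
def IsEvolved (P : ℝ≥0 → C(Config d q, ℝ) →L[ℝ] C(Config d q, ℝ)) (t : ℝ≥0)
    (ν ρ : ProbabilityMeasure (Config d q)) : Prop :=
  ∀ f : C(Config d q, ℝ), ∫ η, f η ∂(ρ : Measure (Config d q)) =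
    ∫ η, P t f η ∂(ν : Measure (Config d q))

/-- The time-stationary measures. -/
def stationaryMeasures (P : ℝ≥0 → C(Config d q, ℝ) →L[ℝ] C(Config d q, ℝ)) :
    Set (ProbabilityMeasure (Config d q)) :=
  {ν | ∀ s : ℝ≥0, IsEvolved P s ν ν}

/-- The measures that lie on a periodic orbit. -/
def periodicMeasures (P : ℝ≥0 → C(Config d q, ℝ) →L[ℝ] C(Config d q, ℝ)) :
    Set (ProbabilityMeasure (Config d q)) :=
  {ν | ∃ T : ℝ≥0, 0 < T ∧ IsEvolved P T ν ν}

/-- `μ` is a product measure; the one-site marginals may depend on the site. -/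
def IsProductMeasure (μ : ProbabilityMeasure (Config d q)) : Prop :=
  ∃ m : Site d → ProbabilityMeasure (Fin q),
    (μ : Measure (Config d q)) = Measure.infinitePi fun x => (m x : Measure (Fin q))

end IPS

end

/-! Suppose the law ν returns to itself after time T. In the box of radius n, the entropy of the
evolved law relative to the stationary product measure μ is the same at times 0 and T, so its
production integrates to zero. Subtracting the stationarity of μ, tested on the density, turns this
production into at most -κ times a nonnegative dissipation plus an error, which exists only because
the rates see spins outside the box (`flux_log_le`, `integral_dissipation_le`). At the site x the
error is governed by b(n-|x|), the influence from distances larger than n-|x|.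

Let A_n(x) be the dissipation at x over a period and α_n its sum over the box. Optimising a free
parameter gives α_n² ≤ C · (∑_x b(n-|x|)) · (∑_x b(n-|x|) A_n(x)). For d ≤ 2 a sphere of radius m
has O(m+1) sites, and ∑ b(k) is finite by the first moment in the short-range condition, so the
first factor is O(n+1). Because μ is a product measure, A_n(x) is nondecreasing in n
(`dissipation_le`), and summation by parts bounds the second factors, summed over n ≤ N, by a
multiple of α_N (`sum_boundary_le`). Hence ∑_{n≤N} α_n²/(n+1) ≤ C α_N, and the divergence of the
harmonic series forces α = 0 (`eq_zero_of_sum_sq_div_le`). Without dissipation the density is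
constant (`eq_of_dissipation_eq_zero`), so ν and μ agree on every box.

The lower bound on the rates also makes all cylinder masses positive (`mass_pos`), so densities and
logarithms make sense. -/

namespace IPS

/-! ### The entropy production of a finite spin system -/

section FiniteSystem

/-- The convex function `u ↦ u - 1 - log u`. -/
noncomputable def logGap (u : ℝ) : ℝ := u - 1 - Real.log u

theorem logGap_nonneg {u : ℝ} (hu : 0 < u) : 0 ≤ logGap u := by
  have := Real.log_le_sub_one_of_pos hu
  unfold logGap; linarith

theorem logGap_one : logGap 1 = 0 := by simp [logGap]

theorem eq_one_of_logGap_eq_zero {u : ℝ} (hu : 0 < u) (h : logGap u = 0) : u = 1 := by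
  by_contra hne
  have := Real.log_lt_sub_one_of_pos hu hne
  unfold logGap at h; linarith

/-- Two separate bounds are needed: `logGap` is of order `u` at infinity and of order `-log u` at 0,
so it controls the square of `log u` only for large `u` and that of `u - 1` only for small `u`. -/
theorem sq_log_le_logGap {u : ℝ} (hu : 1 ≤ u) : Real.log u ^ 2 / 2 ≤ logGap u := by
  have h := Real.quadratic_le_exp_of_nonneg (Real.log_nonneg hu)
  rw [Real.exp_log (by linarith)] at h
  unfold logGap; linarith

theorem sq_one_sub_le_logGap {u : ℝ} (hu : 0 < u) (hu1 : u ≤ 1) :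
    (1 - u) ^ 2 / 2 ≤ logGap u := by
  have hd : ∀ x ∈ Set.Ioi (0 : ℝ), HasDerivAt (fun u : ℝ => logGap u - (1 - u) ^ 2 / 2)
      (1 - x⁻¹ + (1 - x)) x := by
    intro x hx
    have h1 := (((hasDerivAt_id x).sub_const 1).sub (Real.hasDerivAt_log (ne_of_gt hx)))
    have h2 := (((hasDerivAt_id x).const_sub 1).pow 2).div_const 2
    refine (h1.sub h2).congr_deriv ?_
    simp; ring
  have hanti : AntitoneOn (fun u : ℝ => logGap u - (1 - u) ^ 2 / 2) (Set.Ioc 0 1) := by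
    refine antitoneOn_of_deriv_nonpos (convex_Ioc 0 1)
      (fun x hx => (hd x hx.1).continuousAt.continuousWithinAt)
      (fun x hx => ?_) (fun x hx => ?_)
    · rw [interior_Ioc] at hx
      exact (hd x hx.1).differentiableAt.differentiableWithinAt
    · rw [interior_Ioc] at hx
      rw [(hd x hx.1).deriv]
      have hx0 : 0 < x := hx.1
      have : 1 - x⁻¹ + (1 - x) = -((1 - x) ^ 2 / x) := by field_simp; ring
      rw [this]
      have : 0 ≤ (1 - x) ^ 2 / x := by positivity
      linarith
  have := hanti ⟨hu, hu1⟩ ⟨one_pos, le_rfl⟩ hu1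
  simp only [logGap_one] at this
  norm_num at this
  linarith

/-- Young's inequality. The parameter `l` stays free because it is optimised only after summing over
a whole box. -/
theorem le_mul_add_inv {v w l : ℝ} (hl : 0 < l) (h : v ^ 2 / 2 ≤ w) : v ≤ l * w + l⁻¹ := by
  have h1 : l * (v ^ 2 / 2) ≤ l * w := by gcongr
  have h2 : 0 ≤ l * (v - l⁻¹) ^ 2 := by positivity
  have h3 : l * (v - l⁻¹) ^ 2 = l * v ^ 2 - 2 * v + l⁻¹ := by
    field_simp
    ring
  have h4 : 0 < l⁻¹ := by positivity
  nlinarith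

/-- Depending on the sign of `log u`, the error is put on `log u` or on `u - 1`, so that it is
always controlled by the square root of `logGap u`. -/
theorem mul_log_sub_le {u a b κ ε l : ℝ} (hu : 0 < u) (ha : κ ≤ a) (hb : κ ≤ b)
    (hab : |a - b| ≤ ε) (hl : 0 < l) :
    a * Real.log u - b * (u - 1) ≤ -κ * logGap u + ε * (l * logGap u + l⁻¹) := by
  have hε : 0 ≤ ε := (abs_nonneg _).trans hab
  have hφ := logGap_nonneg hu
  rcases le_total 1 u with h | h
  · have h1 : Real.log u ≤ l * logGap u + l⁻¹ := le_mul_add_inv hl (sq_log_le_logGap h)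
    have h2 : (a - b) * Real.log u ≤ ε * (l * logGap u + l⁻¹) :=
      mul_le_mul ((le_abs_self _).trans hab) h1 (Real.log_nonneg h) hε
    have h3 : κ * logGap u ≤ b * logGap u := by gcongr
    have h4 : a * Real.log u - b * (u - 1) = -(b * logGap u) + (a - b) * Real.log u := by
      unfold logGap; ring
    linarith
  · have h1 : 1 - u ≤ l * logGap u + l⁻¹ := le_mul_add_inv hl (sq_one_sub_le_logGap hu h)
    have h2 : (b - a) * (1 - u) ≤ ε * (l * logGap u + l⁻¹) := by
      refine mul_le_mul ((le_abs_self _).trans ?_) h1 (by linarith) hε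
      rwa [abs_sub_comm]
    have h3 : κ * logGap u ≤ a * logGap u := by gcongr
    have h4 : a * Real.log u - b * (u - 1) = -(a * logGap u) + (b - a) * (1 - u) := by
      unfold logGap; ring
    linarith

theorem forall_of_update {ι α : Type*} [Fintype ι] [DecidableEq ι] {Q : (ι → α) → Prop}
    (h : ∀ σ x i, Q σ → Q (Function.update σ x i)) {τ : ι → α} (hτ : Q τ) (σ : ι → α) : Q σ := by
  classical
  have : ∀ s : Finset ι, Q (s.piecewise σ τ) := by
    intro s
    induction s using Finset.induction_on with
    | empty => simpa using hτ
    | insert a s ha ih => rw [Finset.piecewise_insert]; exact h _ _ _ ih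
  simpa using this Finset.univ

variable {ι α : Type*} [Fintype ι] [DecidableEq ι] [Fintype α]

/-- The rate of change of the mean of `f` when the mass flows from `σ` to `σ^{x,i}` at the
rate `r σ x i`. -/
def flux (r : (ι → α) → ι → α → ℝ) (f : (ι → α) → ℝ) : ℝ :=
  ∑ σ, ∑ x, ∑ i, r σ x i * (f (Function.update σ x i) - f σ)

/-- The dissipation at the site `x` of the mass function `p` relative to `m`. -/
noncomputable def dissipation (p m : (ι → α) → ℝ) (x : ι) : ℝ :=
  ∑ i, ∑ σ, p σ * logGap (p (Function.update σ x i) / m (Function.update σ x i) / (p σ / m σ))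

theorem dissipation_nonneg {p m : (ι → α) → ℝ} (hp : ∀ σ, 0 < p σ) (hm : ∀ σ, 0 < m σ) (x : ι) :
    0 ≤ dissipation p m x := by
  refine Finset.sum_nonneg fun i _ => Finset.sum_nonneg fun σ _ => mul_nonneg (hp σ).le ?_
  exact logGap_nonneg (div_pos (div_pos (hp _) (hm _)) (div_pos (hp _) (hm _)))

/-- By linearity in `f`, expanded in indicators of single configurations. It converts derivatives of
the masses into derivatives of means. -/
theorem flux_sum_mul (r : (ι → α) → ι → α → ℝ) [DecidableEq (ι → α)] (f : (ι → α) → ℝ) :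
    ∑ τ, flux r (Pi.single τ 1) * f τ = flux r f := by
  simp only [flux, Finset.sum_mul]
  rw [Finset.sum_comm]
  refine Finset.sum_congr rfl fun σ _ => ?_
  rw [Finset.sum_comm]
  refine Finset.sum_congr rfl fun x _ => ?_
  rw [Finset.sum_comm]
  refine Finset.sum_congr rfl fun i _ => ?_
  simp only [mul_assoc, ← Finset.mul_sum, sub_mul, Finset.sum_sub_distrib, Pi.single_apply,
    ite_mul, one_mul, zero_mul]
  simp

/-- Subtract the vanishing flux of the density `p / m` under the reference jumps `s`. With `u` the
ratio of the densities after and before a jump, each term becomes `p σ` times `a * log u - b * (u -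
1)`, where `a = r / p` and `b = s / m` are conditional rates. Null jumps have `u = 1`, so `a` and
`b` need to be close only for genuine jumps. -/
theorem flux_log_le {p m : (ι → α) → ℝ} {r s : (ι → α) → ι → α → ℝ} {κ l : ℝ} {ε : ι → ℝ}
    (hp : ∀ σ, 0 < p σ) (hm : ∀ σ, 0 < m σ) (hp1 : ∑ σ, p σ = 1)
    (hs : ∀ f, flux s f = 0)
    (hrκ : ∀ σ x i, κ * p σ ≤ r σ x i) (hsκ : ∀ σ x i, κ * m σ ≤ s σ x i)
    (hε : ∀ x, 0 ≤ ε x)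
    (hrs : ∀ σ x i, σ x ≠ i → |r σ x i / p σ - s σ x i / m σ| ≤ ε x) (hl : 0 < l) :
    flux r (fun σ => Real.log (p σ / m σ)) ≤ -κ * ∑ x, dissipation p m x +
      ∑ x, ε x * (l * dissipation p m x + l⁻¹ * Fintype.card α) := by
  have hterm : ∀ σ x i, r σ x i * (Real.log (p (Function.update σ x i) /
        m (Function.update σ x i)) - Real.log (p σ / m σ)) -
      s σ x i * (p (Function.update σ x i) / m (Function.update σ x i) - p σ / m σ) ≤
      p σ * (-κ * logGap (p (Function.update σ x i) / m (Function.update σ x i) / (p σ / m σ)) +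
        ε x * (l * logGap (p (Function.update σ x i) / m (Function.update σ x i) / (p σ / m σ))
          + l⁻¹)) := by
    intro σ x i
    have hg : ∀ σ, 0 < p σ / m σ := fun σ => div_pos (hp σ) (hm σ)
    by_cases hi : σ x = i
    · subst hi
      rw [Function.update_eq_self, div_self (hg σ).ne', logGap_one]
      have := hε x
      have := (hp σ).le
      simp only [sub_self, mul_zero, zero_add]
      positivity
    · rw [← Real.log_div (hg _).ne' (hg _).ne']
      set u := p (Function.update σ x i) / m (Function.update σ x i) / (p σ / m σ) with hu
      have hu0 : 0 < u := div_pos (hg _) (hg _)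
      have h1 := mul_log_sub_le hu0 (κ := κ) ((le_div_iff₀ (hp σ)).2 (hrκ σ x i))
        ((le_div_iff₀ (hm σ)).2 (hsκ σ x i)) (hrs σ x i hi) hl
      have h2 := mul_le_mul_of_nonneg_left h1 (hp σ).le
      refine le_trans (le_of_eq ?_) h2
      have h3 : p (Function.update σ x i) / m (Function.update σ x i) = u * (p σ / m σ) := by
        rw [hu, div_mul_cancel₀ _ (hg σ).ne']
      rw [h3]
      have := (hp σ).ne'
      have := (hm σ).ne'
      field_simp
  have h1 : flux r (fun σ => Real.log (p σ / m σ)) =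
      ∑ σ, ∑ x, ∑ i, (r σ x i * (Real.log (p (Function.update σ x i) /
        m (Function.update σ x i)) - Real.log (p σ / m σ)) -
      s σ x i * (p (Function.update σ x i) / m (Function.update σ x i) - p σ / m σ)) := by
    have := hs (fun σ => p σ / m σ)
    simp only [flux] at this ⊢
    simp only [Finset.sum_sub_distrib]
    rw [this, sub_zero]
  rw [h1]
  refine (Finset.sum_le_sum fun σ _ => Finset.sum_le_sum fun x _ => Finset.sum_le_sum fun i _ =>
    hterm σ x i).trans (le_of_eq ?_)
  rw [Finset.sum_comm, Finset.mul_sum, ← Finset.sum_add_distrib]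
  refine Finset.sum_congr rfl fun x _ => ?_
  rw [Finset.sum_comm]
  have h2 : (Fintype.card α : ℝ) = ∑ _i : α, ∑ σ, p σ := by simp [hp1]
  rw [h2]
  simp only [dissipation, Finset.mul_sum, mul_add, ← Finset.sum_add_distrib]
  refine Finset.sum_congr rfl fun i _ => Finset.sum_congr rfl fun σ _ => ?_
  ring

/-- The log-sum inequality for `logGap`. -/
theorem mul_logGap_le_sum {β : Type*} (t : Finset β) {a b : β → ℝ}
    (hne : t.Nonempty) (ha : ∀ k ∈ t, 0 < a k) (hb : ∀ k ∈ t, 0 < b k) :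
    (∑ k ∈ t, a k) * logGap ((∑ k ∈ t, b k) / ∑ k ∈ t, a k) ≤
      ∑ k ∈ t, a k * logGap (b k / a k) := by
  set A := ∑ k ∈ t, a k
  set B := ∑ k ∈ t, b k
  have hA : 0 < A := Finset.sum_pos ha hne
  have hB : 0 < B := Finset.sum_pos hb hne
  -- The left side is the tangent plane at `(A, B)` of the convex, 1-homogeneous function `a *
  -- logGap (b / a)`.
  have hk : ∀ k ∈ t, b k - a k * Real.log (B / A) - b k * (A / B) ≤
      a k * logGap (b k / a k) := by
    intro k hk
    have hak := ha k hk
    have hbk := hb k hk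
    have h1 := Real.log_le_sub_one_of_pos (x := (b k / a k) / (B / A)) (by positivity)
    rw [Real.log_div (by positivity) (by positivity)] at h1
    have h2 := mul_le_mul_of_nonneg_left h1 hak.le
    have h3 : a k * (b k / a k / (B / A) - 1) = b k * (A / B) - a k := by field_simp
    have h4 : a k * (b k / a k) = b k := by field_simp
    rw [h3] at h2
    unfold logGap
    nlinarith
  refine le_trans (le_of_eq ?_) (Finset.sum_le_sum hk)
  simp only [Finset.sum_sub_distrib, ← Finset.sum_mul]
  change A * logGap (B / A) = B - A * Real.log (B / A) - B * (A / B)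
  unfold logGap
  field_simp
  ring

/-- If `m σ / m (σ^{x,i})` depends only on `σ x` and `i`, the dissipation increases with the set
of sites. -/
theorem dissipation_le {ι' : Type*} [Fintype ι'] [DecidableEq ι'] [DecidableEq α]
    (j : ι → ι') (hj : Function.Injective j)
    {p m : (ι → α) → ℝ} {p' m' : (ι' → α) → ℝ}
    (hp' : ∀ σ, 0 < p' σ) (hm : ∀ σ, 0 < m σ) (hm' : ∀ σ, 0 < m' σ)
    (hpp : ∀ σ, p σ = ∑ τ with τ ∘ j = σ, p' τ) (x : ι) (w : α → α → ℝ)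
    (hw : ∀ σ i, m σ = w (σ x) i * m (Function.update σ x i))
    (hw' : ∀ τ i, m' τ = w (τ (j x)) i * m' (Function.update τ (j x) i)) :
    dissipation p m x ≤ dissipation p' m' (j x) := by
  classical
  refine Finset.sum_le_sum fun i _ => ?_
  rw [← Finset.sum_fiberwise Finset.univ (fun τ : ι' → α => τ ∘ j)]
  refine Finset.sum_le_sum fun σ _ => ?_
  have hup : ∀ (τ : ι' → α) (a : α), Function.update τ (j x) a ∘ j =
      Function.update (τ ∘ j) x a := fun τ a => Function.update_comp_eq_of_injective τ hj x a
  have hne : (Finset.univ.filter fun τ : ι' → α => τ ∘ j = σ).Nonempty := by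
    have : Nonempty α := ⟨i⟩
    exact ⟨Function.extend j σ (fun _ => i), by simp [Function.extend_comp hj]⟩
  have hw0 : 0 < w (σ x) i := by
    by_contra h
    have h1 := hw σ i
    have h2 := hm (Function.update σ x i)
    have h3 := hm σ
    nlinarith
  -- Setting the spin at `j x` to `i` is a bijection from the fibre over `σ` to the fibre over
  -- `σ^{x,i}`; resetting it to `σ x` is the inverse.
  have hflip : p (Function.update σ x i) =
      ∑ τ with τ ∘ j = σ, p' (Function.update τ (j x) i) := by
    rw [hpp]
    refine Finset.sum_bij' (fun τ _ => Function.update τ (j x) (σ x))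
      (fun τ _ => Function.update τ (j x) i) ?_ ?_ ?_ ?_ ?_
    · intro τ hτ
      simp only [Finset.mem_filter, Finset.mem_univ, true_and] at hτ ⊢
      rw [hup, hτ, Function.update_idem, Function.update_eq_self]
    · intro τ hτ
      simp only [Finset.mem_filter, Finset.mem_univ, true_and] at hτ ⊢
      rw [hup, hτ]
    · intro τ hτ
      simp only [Finset.mem_filter, Finset.mem_univ, true_and] at hτ
      rw [Function.update_idem]
      have : τ (j x) = i := by
        have := congrFun hτ x
        simpa using this
      rw [← this, Function.update_eq_self]
    · intro τ hτ
      simp only [Finset.mem_filter, Finset.mem_univ, true_and] at hτ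
      rw [Function.update_idem, ← hτ]
      exact Function.update_eq_self _ _
    · intro τ hτ
      simp only [Finset.mem_filter, Finset.mem_univ, true_and] at hτ
      rw [Function.update_idem]
      have : τ (j x) = i := by
        have := congrFun hτ x
        simpa using this
      rw [← this, Function.update_eq_self]
  -- The factor `w (σ x) i` is constant on the fibre, hence comes out of the sum; this is where the
  -- product form of the reference measure matters.
  have key := mul_logGap_le_sum (Finset.univ.filter fun τ : ι' → α => τ ∘ j = σ)
    (a := p') (b := fun τ => w (σ x) i * p' (Function.update τ (j x) i)) hne
    (fun τ _ => hp' τ) (fun τ _ => mul_pos hw0 (hp' _))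
  rw [← Finset.mul_sum, ← hflip, ← hpp] at key
  have e1 : p (Function.update σ x i) / m (Function.update σ x i) / (p σ / m σ) =
      w (σ x) i * p (Function.update σ x i) / p σ := by
    have h2 := (hm (Function.update σ x i)).ne'
    rw [hw σ i]
    field_simp
  rw [e1]
  refine key.trans (le_of_eq (Finset.sum_congr rfl fun τ hτ => ?_))
  simp only [Finset.mem_filter, Finset.mem_univ, true_and] at hτ
  have h2 := (hm' (Function.update τ (j x) i)).ne'
  have h3 : τ (j x) = σ x := congrFun hτ x
  rw [hw' τ i, h3]
  congr 2
  field_simp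

/-- `logGap` vanishes only at 1, so the density is unchanged by single-site updates. These connect
all configurations, and normalisation fixes the constant. -/
theorem eq_of_dissipation_eq_zero {p m : (ι → α) → ℝ} (hp : ∀ σ, 0 < p σ) (hm : ∀ σ, 0 < m σ)
    (hp1 : ∑ σ, p σ = 1) (hm1 : ∑ σ, m σ = 1) (h : ∀ x, dissipation p m x = 0) : p = m := by
  have hg : ∀ σ, 0 < p σ / m σ := fun σ => div_pos (hp σ) (hm σ)
  have h0 : ∀ σ x i, p (Function.update σ x i) / m (Function.update σ x i) = p σ / m σ := by
    intro σ x i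
    have h1 : ∀ i ∈ Finset.univ, (0 : ℝ) ≤ ∑ σ, p σ * logGap (p (Function.update σ x i) /
        m (Function.update σ x i) / (p σ / m σ)) := fun i _ => Finset.sum_nonneg fun σ _ =>
      mul_nonneg (hp σ).le (logGap_nonneg (div_pos (hg _) (hg _)))
    have h2 := (Finset.sum_eq_zero_iff_of_nonneg h1).1 (h x) i (Finset.mem_univ _)
    have h3 := (Finset.sum_eq_zero_iff_of_nonneg fun σ _ => mul_nonneg (hp σ).le
      (logGap_nonneg (div_pos (hg _) (hg _)))).1 h2 σ (Finset.mem_univ _)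
    have h4 := eq_one_of_logGap_eq_zero (div_pos (hg _) (hg _))
      ((mul_eq_zero.1 h3).resolve_left (hp σ).ne')
    exact (div_eq_one_iff_eq (hg σ).ne').1 h4
  have hc : ∀ σ τ, p σ / m σ = p τ / m τ := fun σ τ =>
    forall_of_update (Q := fun ρ => p ρ / m ρ = p τ / m τ) (fun ρ x i hρ => (h0 ρ x i).trans hρ)
      rfl σ
  funext σ
  have h1 : ∀ τ, p τ = p σ / m σ * m τ := fun τ => by
    rw [← hc τ σ, div_mul_cancel₀ _ (hm τ).ne']
  have h2 : p σ / m σ = 1 := by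
    rw [Finset.sum_congr rfl fun τ _ => h1 τ, ← Finset.mul_sum, hm1, mul_one] at hp1
    exact hp1
  rw [h1 σ, h2, one_mul]

end FiniteSystem

/-! ### A discrete differential inequality -/

section Sequences

/-- Abel summation: raising the weight of a nonnegative partial sum can only increase the total. The
full sum may have either sign. -/
theorem sum_mul_le_of_partial_sums_nonneg {w s : ℕ → ℝ} (n : ℕ)
    (hw : ∀ i j, i ≤ j → j ≤ n → w i ≤ w j)
    (hs : ∀ k ≤ n, 0 ≤ ∑ i ∈ Finset.range k, s i) :
    ∑ i ∈ Finset.range (n + 1), w i * s i ≤ w n * ∑ i ∈ Finset.range (n + 1), s i := by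
  induction n with
  | zero => simp
  | succ n ih =>
    rw [Finset.sum_range_succ, Finset.sum_range_succ (fun i => s i), mul_add]
    have h1 := ih (fun i j hij hj => hw i j hij (by omega)) (fun k hk => hs k (by omega))
    have h2 := mul_le_mul_of_nonneg_right (hw n (n + 1) (by omega) le_rfl) (hs (n + 1) le_rfl)
    linarith

/-- Summation of the mass near the boundary of the growing boxes. -/
theorem sum_boundary_le {b : ℕ → ℝ} {B : ℝ}
    (hanti : Antitone b) (hB : ∀ K, ∑ k ∈ Finset.range K, b k ≤ B)
    {S : ℕ → ℕ → ℝ} {α : ℕ → ℝ} (hα : ∀ n, α n = ∑ m ∈ Finset.range (n + 1), S n m)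
    (hmono : ∀ k n, k ≤ n → α k ≤ ∑ m ∈ Finset.range (k + 1), S n m) (h0 : Monotone α)
    (h00 : 0 ≤ α 0) (N : ℕ) :
    ∑ n ∈ Finset.range (N + 1), ∑ m ∈ Finset.range (n + 1), b (n - m) * S n m ≤ B * α N := by
  -- The increments of `α`.
  let Δ : ℕ → ℝ := fun j => if j = 0 then α 0 else α j - α (j - 1)
  have hΔ0 : ∀ j, 0 ≤ Δ j := by
    intro j
    simp only [Δ]
    split_ifs with h
    · exact h00
    · exact sub_nonneg.2 (h0 (by omega))
  have hΔ : ∀ n, ∑ j ∈ Finset.range (n + 1), Δ j = α n := by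
    intro n
    induction n with
    | zero => simp [Δ]
    | succ n ih => rw [Finset.sum_range_succ, ih]; simp [Δ]
  -- The partial sums of `S n` dominate those of `Δ`, with equality at the end, and the weight `b (n
  -- - m)` increases with `m`. Replacing `S n` by `Δ` therefore moves mass outwards, to larger
  -- weights.
  have h1 : ∀ n, ∑ m ∈ Finset.range (n + 1), b (n - m) * S n m ≤
      ∑ m ∈ Finset.range (n + 1), b (n - m) * Δ m := by
    intro n
    have := sum_mul_le_of_partial_sums_nonneg (w := fun m => b (n - m))
      (s := fun m => S n m - Δ m) n (fun i j hij _ => hanti (by omega)) (by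
        intro k hk
        rw [Finset.sum_sub_distrib]
        rcases k with _ | k
        · simp
        · rw [hΔ]
          exact sub_nonneg.2 (hmono k n (by omega)))
    rw [Finset.sum_sub_distrib, hΔ, ← hα, sub_self, mul_zero] at this
    simp only [mul_sub, Finset.sum_sub_distrib] at this
    linarith
  refine (Finset.sum_le_sum fun n _ => h1 n).trans ?_
  -- After the exchange of sums, each increment `Δ m` carries a partial sum of `b`, at most `B`.
  have h2 : ∑ n ∈ Finset.range (N + 1), ∑ m ∈ Finset.range (n + 1), b (n - m) * Δ m =
      ∑ m ∈ Finset.range (N + 1), ∑ n ∈ Finset.Ico m (N + 1), b (n - m) * Δ m := by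
    refine Finset.sum_comm' fun n m => ?_
    simp only [Finset.mem_range, Finset.mem_Ico]
    omega
  rw [h2, ← hΔ N, Finset.mul_sum]
  refine Finset.sum_le_sum fun m _ => ?_
  rw [← Finset.sum_mul, Finset.sum_Ico_eq_sum_range]
  refine mul_le_mul_of_nonneg_right ?_ (hΔ0 m)
  simpa using hB (N + 1 - m)

/-- A nonnegative sequence whose weighted square sums are dominated by the sequence itself
vanishes, because the harmonic series diverges. -/
theorem eq_zero_of_sum_sq_div_le {α : ℕ → ℝ} {C : ℝ} (hα : ∀ n, 0 ≤ α n)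
    (h : ∀ N, ∑ n ∈ Finset.range (N + 1), α n ^ 2 / (n + 1) ≤ C * α N) (n : ℕ) : α n = 0 := by
  by_contra hne
  set s : ℕ → ℝ := fun N => ∑ n ∈ Finset.range (N + 1), α n ^ 2 / (n + 1) with hs
  have hstep : ∀ N, s (N + 1) = s N + α (N + 1) ^ 2 / ((N + 1 : ℕ) + 1) := fun N => by
    simp only [hs]
    rw [Finset.sum_range_succ _ (N + 1)]
  have hmono : Monotone s := monotone_nat_of_le_succ fun N => by
    rw [hstep]
    have : 0 ≤ α (N + 1) ^ 2 / ((N + 1 : ℕ) + 1) := by positivity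
    linarith
  have hpos : 0 < s n := by
    have : 0 < α n := lt_of_le_of_ne (hα n) (Ne.symm hne)
    simp only [hs]
    rw [Finset.sum_range_succ]
    have h1 : 0 ≤ ∑ x ∈ Finset.range n, α x ^ 2 / ((x : ℝ) + 1) :=
      Finset.sum_nonneg fun i _ => by positivity
    positivity
  -- Discrete form of `s' ≥ s² / (C² n)`: integrating `s' / s²` makes the reciprocals of `s`
  -- telescope, so they bound a piece of the harmonic series.
  have hkey : ∀ k : ℕ, ∑ j ∈ Finset.range k, (1 : ℝ) / ((n + j + 1 : ℕ) + 1) ≤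
      C ^ 2 * (1 / s n - 1 / s (n + k)) := by
    intro k
    induction k with
    | zero => simp
    | succ k ih =>
      rw [Finset.sum_range_succ]
      have hp1 : 0 < s (n + k) := hpos.trans_le (hmono (by omega))
      have hp2 : 0 < s (n + k + 1) := hpos.trans_le (hmono (by omega))
      have hle : s (n + k) ≤ s (n + k + 1) := hmono (by omega)
      have h1 : s (n + k + 1) ^ 2 ≤ C ^ 2 * α (n + k + 1) ^ 2 := by
        rw [← mul_pow]
        exact pow_le_pow_left₀ hp2.le (h _) 2
      have h2 : α (n + k + 1) ^ 2 = (s (n + k + 1) - s (n + k)) * ((n + k + 1 : ℕ) + 1) := by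
        rw [hstep (n + k)]
        field_simp
        ring
      rw [h2] at h1
      have h3 : (1 : ℝ) / ((n + k + 1 : ℕ) + 1) ≤ C ^ 2 * (1 / s (n + k) - 1 / s (n + k + 1)) := by
        have h4 : 1 / s (n + k) - 1 / s (n + k + 1) =
            (s (n + k + 1) - s (n + k)) / (s (n + k) * s (n + k + 1)) := by field_simp
        rw [h4, ← mul_div_assoc, div_le_div_iff₀ (by positivity) (by positivity)]
        calc 1 * (s (n + k) * s (n + k + 1)) ≤ s (n + k + 1) ^ 2 := by nlinarith
          _ ≤ _ := h1
          _ = _ := by ring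
      have h5 : n + (k + 1) = n + k + 1 := rfl
      rw [h5]
      linarith
  have hbd : ∀ k : ℕ, ∑ j ∈ Finset.range k, (1 : ℝ) / ((n + j + 1 : ℕ) + 1) ≤ C ^ 2 * (1 / s n) := by
    intro k
    have hp1 : 0 < s (n + k) := hpos.trans_le (hmono (by omega))
    refine (hkey k).trans (mul_le_mul_of_nonneg_left ?_ (sq_nonneg C))
    have : 0 < 1 / s (n + k) := by positivity
    linarith
  have hsum : Summable fun j : ℕ => (1 : ℝ) / ((n + j + 1 : ℕ) + 1) :=
    summable_of_sum_range_le (fun j => by positivity) hbd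
  have h2 := (summable_nat_add_iff (n + 2) (f := fun j : ℕ => (1 : ℝ) / j)).1 (by
    refine hsum.congr fun j => ?_
    push_cast
    ring_nf)
  exact Real.not_summable_one_div_natCast h2

end Sequences
/-! ### The generator on cylinder functions -/

section Cylinder

variable {d q : ℕ} {c : Rates d q}

/-- The function of the configuration that depends, through `f`, only on the spins in `Λ`. -/
noncomputable def cylFun (Λ : Finset (Site d)) (f : (Λ → Fin q) → ℝ) : C(Config d q, ℝ) where
  toFun η := f (Λ.restrict η)
  continuous_toFun := (continuous_of_discreteTopology (f := f)).comp Λ.continuous_restrict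

@[simp]
theorem cylFun_apply (Λ : Finset (Site d)) (f : (Λ → Fin q) → ℝ) (η : Config d q) :
    cylFun Λ f η = f (Λ.restrict η) := rfl

/-- The rate of the jumps at `x` to `i` as a continuous function. -/
noncomputable def rateFun (hc : RateConditions c) (x : Site d) (i : Fin q) : C(Config d q, ℝ) :=
  ⟨fun η => c x η i, hc.continuous x i⟩

@[simp]
theorem rateFun_apply (hc : RateConditions c) (x : Site d) (i : Fin q) (η : Config d q) :
    rateFun hc x i η = c x η i := rfl

/-- The generator on cylinder functions. -/
noncomputable def cylGen (hc : RateConditions c) (Λ : Finset (Site d)) (f : (Λ → Fin q) → ℝ) :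
    C(Config d q, ℝ) :=
  ∑ x : Λ, ∑ i, rateFun hc x i * (cylFun Λ (fun σ => f (Function.update σ x i)) - cylFun Λ f)

theorem restrict_update {Λ : Finset (Site d)} (η : Config d q) (x : Λ) (i : Fin q) :
    Λ.restrict (Function.update η x i) = Function.update (Λ.restrict η) x i := by
  ext y
  by_cases h : y = x
  · subst h; simp
  · have : (y : Site d) ≠ x := fun h' => h (Subtype.ext h')
    simp [h, this]

theorem restrict_update_of_notMem {Λ : Finset (Site d)} (η : Config d q) {x : Site d} (hx : x ∉ Λ)
    (i : Fin q) : Λ.restrict (Function.update η x i) = Λ.restrict η := by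
  ext y
  have : (y : Site d) ≠ x := fun h => hx (h ▸ y.2)
  simp [this]

theorem cylFun_mem_pregeneratorGraph (hc : RateConditions c) (Λ : Finset (Site d))
    (f : (Λ → Fin q) → ℝ) : (cylFun Λ f, cylGen hc Λ f) ∈ pregeneratorGraph c := by
  refine ⟨?_, fun η => ?_⟩
  · have h0 : ∀ x ∉ Λ, osc x (cylFun Λ f : Config d q → ℝ) = 0 := by
      intro x hx
      simp only [osc, ENNReal.iSup_eq_zero]
      intro η ξ h
      have : Λ.restrict η = Λ.restrict ξ := by
        ext y
        have : (y : Site d) ≠ x := fun h => hx (h ▸ y.2)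
        simp [h y this]
      simp [this]
    rw [tsum_eq_sum (s := Λ) (fun x hx => h0 x hx), ENNReal.sum_lt_top]
    intro x _
    refine lt_of_le_of_lt (b := 2 * ‖cylFun Λ f‖ₑ) ?_ (ENNReal.mul_lt_top (by simp) (by simp))
    refine iSup_le fun η => iSup_le fun ξ => iSup_le fun _ => ?_
    refine (enorm_sub_le).trans ?_
    have h1 : ∀ η, ‖cylFun Λ f η‖ₑ ≤ ‖cylFun Λ f‖ₑ := fun η => by
      simpa [enorm_le_iff_norm_le] using (cylFun Λ f).norm_coe_le_norm η
    rw [two_mul]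
    exact add_le_add (h1 η) (h1 ξ)
  · have h1 := hasSum_sum_of_ne_finset_zero (s := Λ) (L := .unconditional (Site d))
      (f := fun x : Site d => ∑ i : Fin q, c x η i * (cylFun Λ f (Function.update η x i) -
        cylFun Λ f η)) (by
        intro x hx
        refine Finset.sum_eq_zero fun i _ => ?_
        simp [restrict_update_of_notMem η hx])
    convert h1 using 1
    rw [← Finset.sum_coe_sort]
    simp [cylGen, ContinuousMap.sum_apply, restrict_update]

/-- The mass that a functional gives to the cylinder of `σ`. -/
noncomputable def mass (ℓ : C(Config d q, ℝ) →L[ℝ] ℝ) (Λ : Finset (Site d)) (σ : Λ → Fin q) : ℝ :=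
  ℓ (cylFun Λ (Pi.single σ 1))

/-- The total rate of the jumps at `x` to `i` from the cylinder of `σ`. -/
noncomputable def jump (hc : RateConditions c) (ℓ : C(Config d q, ℝ) →L[ℝ] ℝ) (Λ : Finset (Site d))
    (σ : Λ → Fin q) (x : Λ) (i : Fin q) : ℝ :=
  ℓ (cylFun Λ (Pi.single σ 1) * rateFun hc x i)

theorem map_cylFun (ℓ : C(Config d q, ℝ) →L[ℝ] ℝ) (Λ : Finset (Site d)) (f : (Λ → Fin q) → ℝ) :
    ℓ (cylFun Λ f) = ∑ σ, mass ℓ Λ σ * f σ := by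
  have : cylFun Λ f = ∑ σ, f σ • cylFun Λ (Pi.single σ 1) := by
    ext η
    simp [ContinuousMap.sum_apply, Pi.single_apply]
  rw [this, map_sum]
  simp [mass, mul_comm]

/-- At a given configuration only the cylinder containing it contributes. The rates see spins
outside `Λ`, so `jump` does not factor through `mass`; their quotient is a conditional mean rate. -/
theorem map_cylGen (hc : RateConditions c) (ℓ : C(Config d q, ℝ) →L[ℝ] ℝ) (Λ : Finset (Site d))
    (f : (Λ → Fin q) → ℝ) : ℓ (cylGen hc Λ f) = flux (jump hc ℓ Λ) f := by
  have : cylGen hc Λ f = ∑ σ, ∑ x : Λ, ∑ i, (f (Function.update σ x i) - f σ) •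
      (cylFun Λ (Pi.single σ 1) * rateFun hc x i) := by
    ext η
    simp only [cylGen, ContinuousMap.sum_apply, ContinuousMap.mul_apply, ContinuousMap.sub_apply,
      ContinuousMap.smul_apply, cylFun_apply, rateFun_apply, Pi.single_apply, smul_eq_mul]
    rw [Finset.sum_eq_single (Λ.restrict η)]
    · simp [mul_comm]
    · intro σ _ hσ
      simp [hσ.symm]
    · simp
  rw [this]
  simp only [map_sum, map_smul, flux, jump, smul_eq_mul, mul_comm]

end Cylinder

/-! ### Periodic flows of positive functionals -/

section Flow

variable {d q : ℕ} {c : Rates d q}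

/-- A periodic solution of the forward equation on cylinder functions. -/
structure IsPeriodicFlow (hc : RateConditions c) (T : ℝ)
    (ℓ : ℝ → C(Config d q, ℝ) →L[ℝ] ℝ) : Prop where
  pos : 0 < T
  nonneg : ∀ s f, 0 ≤ f → 0 ≤ ℓ s f
  one : ∀ s, ℓ s 1 = 1
  continuous : ∀ f, Continuous fun s => ℓ s f
  -- The generator is a limit as time decreases to 0, so only right derivatives are available; they
  -- suffice for the fundamental theorem of calculus.
  deriv : ∀ s, 0 ≤ s → ∀ Λ f, HasDerivWithinAt (fun s => ℓ s (cylFun Λ f))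
    (ℓ s (cylGen hc Λ f)) (Set.Ioi s) s
  periodic : ∀ s, 0 ≤ s → ℓ (s + T) = ℓ s

namespace IsPeriodicFlow

variable {hc : RateConditions c} {T : ℝ} {ℓ : ℝ → C(Config d q, ℝ) →L[ℝ] ℝ}

theorem mono (h : IsPeriodicFlow hc T ℓ) (s : ℝ) {f g : C(Config d q, ℝ)} (hfg : f ≤ g) :
    ℓ s f ≤ ℓ s g := by
  have := h.nonneg s (g - f) (sub_nonneg.2 hfg)
  rw [map_sub] at this
  linarith

theorem mass_nonneg (h : IsPeriodicFlow hc T ℓ) (s : ℝ) (Λ : Finset (Site d)) (σ : Λ → Fin q) :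
    0 ≤ mass (ℓ s) Λ σ := by
  refine h.nonneg s _ fun η => ?_
  change (0 : ℝ) ≤ (Pi.single σ 1 : (Λ → Fin q) → ℝ) (Λ.restrict η)
  rw [Pi.single_apply]
  split_ifs <;> norm_num

theorem sum_mass (h : IsPeriodicFlow hc T ℓ) (s : ℝ) (Λ : Finset (Site d)) :
    ∑ σ, mass (ℓ s) Λ σ = 1 := by
  have := map_cylFun (ℓ s) Λ (fun _ => 1)
  simp only [mul_one] at this
  rw [← this]
  exact h.one s

theorem mul_mass_le_jump (h : IsPeriodicFlow hc T ℓ) (s : ℝ) (Λ : Finset (Site d))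
    (σ : Λ → Fin q) (x : Λ) (i : Fin q) {κ : ℝ}
    (hκ : ∀ η : Config d q, Λ.restrict η = σ → κ ≤ c x η i) :
    κ * mass (ℓ s) Λ σ ≤ jump hc (ℓ s) Λ σ x i := by
  rw [mass, ← smul_eq_mul, ← map_smul]
  refine h.mono s fun η => ?_
  by_cases hη : Λ.restrict η = σ
  · simpa [hη] using hκ η hη
  · simp [hη]

theorem jump_le_mul_mass (h : IsPeriodicFlow hc T ℓ) (s : ℝ) (Λ : Finset (Site d))
    (σ : Λ → Fin q) (x : Λ) (i : Fin q) {K : ℝ}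
    (hK : ∀ η : Config d q, Λ.restrict η = σ → c x η i ≤ K) :
    jump hc (ℓ s) Λ σ x i ≤ K * mass (ℓ s) Λ σ := by
  rw [mass, ← smul_eq_mul, ← map_smul]
  refine h.mono s fun η => ?_
  by_cases hη : Λ.restrict η = σ
  · simpa [hη] using hK η hη
  · simp [hη]

theorem continuous_mass (h : IsPeriodicFlow hc T ℓ) (Λ : Finset (Site d)) (σ : Λ → Fin q) :
    Continuous fun s => mass (ℓ s) Λ σ := h.continuous _

theorem continuous_jump (h : IsPeriodicFlow hc T ℓ) (Λ : Finset (Site d)) (σ : Λ → Fin q) (x : Λ)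
    (i : Fin q) : Continuous fun s => jump hc (ℓ s) Λ σ x i := h.continuous _

theorem hasDerivWithinAt_mass (h : IsPeriodicFlow hc T ℓ) (Λ : Finset (Site d)) (σ : Λ → Fin q)
    {s : ℝ} (hs : 0 ≤ s) : HasDerivWithinAt (fun s => mass (ℓ s) Λ σ)
      (flux (jump hc (ℓ s) Λ) (Pi.single σ 1)) (Set.Ioi s) s := by
  rw [← map_cylGen]
  exact h.deriv s hs Λ _

theorem continuous_flux (h : IsPeriodicFlow hc T ℓ) (Λ : Finset (Site d)) (f : (Λ → Fin q) → ℝ) :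
    Continuous fun s => flux (jump hc (ℓ s) Λ) f := by
  simp only [← map_cylGen]
  exact h.continuous _

/-- Gain minus loss: the cylinder of `σ^{x,i}` receives at least the jumps from `σ`, and it loses
mass at most at the sum of the sup norms of all rates in `Λ`. -/
theorem le_flux_single (h : IsPeriodicFlow hc T ℓ) {κ : ℝ} (hκ0 : 0 ≤ κ)
    (hκ : ∀ x η i, κ ≤ c x η i) (Λ : Finset (Site d))
    (σ : Λ → Fin q) (x : Λ) (i : Fin q) (s : ℝ) :
    κ * mass (ℓ s) Λ σ - (∑ x : Λ, ∑ i, ‖rateFun hc x i‖) * mass (ℓ s) Λ (Function.update σ x i) ≤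
      flux (jump hc (ℓ s) Λ) (Pi.single (Function.update σ x i) 1) := by
  set ρ := Function.update σ x i with hρ
  have hj : ∀ τ (y : Λ) k, 0 ≤ jump hc (ℓ s) Λ τ y k := fun τ y k =>
    (mul_nonneg hκ0 (h.mass_nonneg s Λ τ)).trans
      (h.mul_mass_le_jump s Λ τ y k fun η _ => hκ _ _ _)
  have hsplit : flux (jump hc (ℓ s) Λ) (Pi.single ρ 1) =
      ∑ τ, ∑ y, ∑ k, jump hc (ℓ s) Λ τ y k *
        (Pi.single ρ 1 : (Λ → Fin q) → ℝ) (Function.update τ y k) -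
      ∑ y, ∑ k, jump hc (ℓ s) Λ ρ y k := by
    simp only [flux, mul_sub, Finset.sum_sub_distrib]
    congr 1
    rw [Finset.sum_eq_single ρ]
    · simp
    · intro τ _ hτ
      simp [hτ]
    · simp
  rw [hsplit]
  have hnn : ∀ τ (y : Λ) k, 0 ≤ jump hc (ℓ s) Λ τ y k *
      (Pi.single ρ 1 : (Λ → Fin q) → ℝ) (Function.update τ y k) := fun τ y k => by
    refine mul_nonneg (hj τ y k) ?_
    rw [Pi.single_apply]
    split_ifs <;> norm_num
  have h1 : jump hc (ℓ s) Λ σ x i ≤ ∑ τ, ∑ y, ∑ k, jump hc (ℓ s) Λ τ y k *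
        (Pi.single ρ 1 : (Λ → Fin q) → ℝ) (Function.update τ y k) := by
    refine le_trans (le_of_eq ?_) ((Finset.single_le_sum (fun k _ => hnn σ x k)
      (Finset.mem_univ i)).trans ((Finset.single_le_sum (f := fun y => ∑ k,
        jump hc (ℓ s) Λ σ y k * (Pi.single ρ 1 : (Λ → Fin q) → ℝ) (Function.update σ y k))
      (fun y _ => Finset.sum_nonneg fun k _ => hnn σ y k)
      (Finset.mem_univ x)).trans (Finset.single_le_sum (f := fun τ => ∑ y, ∑ k,
        jump hc (ℓ s) Λ τ y k * (Pi.single ρ 1 : (Λ → Fin q) → ℝ) (Function.update τ y k))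
      (fun τ _ => Finset.sum_nonneg fun y _ => Finset.sum_nonneg fun k _ => hnn τ y k)
      (Finset.mem_univ σ))))
    rw [← hρ]; simp
  have h2 := h.mul_mass_le_jump s Λ σ x i fun η _ => hκ _ _ _
  have h3 : ∑ y, ∑ k, jump hc (ℓ s) Λ ρ y k ≤
      (∑ x : Λ, ∑ i, ‖rateFun hc x i‖) * mass (ℓ s) Λ ρ := by
    simp only [Finset.sum_mul]
    refine Finset.sum_le_sum fun y _ => Finset.sum_le_sum fun k _ => ?_
    refine h.jump_le_mul_mass s Λ ρ y k fun η _ => ?_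
    exact (le_abs_self _).trans ((rateFun hc y k).norm_coe_le_norm η)
  linarith

/-- Multiplied by `exp (K * t)`, each mass is nondecreasing, and it increases strictly while a
neighbouring cylinder has positive mass. Positivity thus spreads over single-site updates within one
period. -/
theorem mass_pos (h : IsPeriodicFlow hc T ℓ) (Λ : Finset (Site d)) (σ : Λ → Fin q) {s : ℝ}
    (hs : 0 ≤ s) : 0 < mass (ℓ s) Λ σ := by
  obtain ⟨κ, hκ0, hκ⟩ := hc.bounded_below
  set K := ∑ x : Λ, ∑ i, ‖rateFun hc x i‖
  have hD : ∀ (ρ : Λ → Fin q) (t : ℝ), 0 ≤ t →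
      HasDerivWithinAt (fun t => Real.exp (K * t) * mass (ℓ t) Λ ρ)
        (Real.exp (K * t) * (K * mass (ℓ t) Λ ρ + flux (jump hc (ℓ t) Λ) (Pi.single ρ 1)))
        (Set.Ioi t) t := by
    intro ρ t ht
    have h1 := (((hasDerivAt_id t).const_mul K).exp.hasDerivWithinAt (s := Set.Ioi t)).mul
      (h.hasDerivWithinAt_mass Λ ρ ht)
    refine h1.congr_deriv ?_
    simp only [id]
    ring
  have hcont : ∀ ρ : Λ → Fin q, Continuous fun t => Real.exp (K * t) * mass (ℓ t) Λ ρ := fun ρ =>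
    (by fun_prop : Continuous fun t => Real.exp (K * t)).mul (h.continuous_mass Λ ρ)
  have hcont' : ∀ ρ : Λ → Fin q, Continuous fun t =>
      Real.exp (K * t) * (K * mass (ℓ t) Λ ρ + flux (jump hc (ℓ t) Λ) (Pi.single ρ 1)) := fun ρ =>
    (by fun_prop : Continuous fun t => Real.exp (K * t)).mul
      (((h.continuous_mass Λ ρ).const_mul K).add (h.continuous_flux Λ _))
  have hint : ∀ (ρ : Λ → Fin q) (a b : ℝ), 0 ≤ a → a ≤ b →
      ∫ t in a..b, Real.exp (K * t) * (K * mass (ℓ t) Λ ρ +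
        flux (jump hc (ℓ t) Λ) (Pi.single ρ 1)) =
        Real.exp (K * b) * mass (ℓ b) Λ ρ - Real.exp (K * a) * mass (ℓ a) Λ ρ := by
    intro ρ a b ha hab
    exact intervalIntegral.integral_eq_sub_of_hasDeriv_right_of_le hab (hcont ρ).continuousOn
      (fun t ht => hD ρ t (ha.trans ht.1.le)) ((hcont' ρ).intervalIntegrable a b)
  have hlow : ∀ (τ : Λ → Fin q) (x : Λ) (i : Fin q) (t : ℝ), κ * mass (ℓ t) Λ τ ≤
      K * mass (ℓ t) Λ (Function.update τ x i) +
        flux (jump hc (ℓ t) Λ) (Pi.single (Function.update τ x i) 1) := fun τ x i t => by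
    have := h.le_flux_single hκ0.le hκ Λ τ x i t
    linarith
  let Q : (Λ → Fin q) → Prop := fun ρ => ∀ s, 0 ≤ s → 0 < mass (ℓ s) Λ ρ
  have hstep : ∀ (τ : Λ → Fin q) (x : Λ) (i : Fin q), Q τ → Q (Function.update τ x i) := by
    intro τ x i hτ s hs
    have h1 : 0 < ∫ t in s..(s + T), Real.exp (K * t) *
        (K * mass (ℓ t) Λ (Function.update τ x i) +
          flux (jump hc (ℓ t) Λ) (Pi.single (Function.update τ x i) 1)) := by
      have hpos : ∀ t, 0 ≤ t → 0 < Real.exp (K * t) *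
          (K * mass (ℓ t) Λ (Function.update τ x i) +
          flux (jump hc (ℓ t) Λ) (Pi.single (Function.update τ x i) 1)) := fun t ht =>
        mul_pos (Real.exp_pos _) ((mul_pos hκ0 (hτ t ht)).trans_le (hlow τ x i t))
      have hT := h.pos
      exact intervalIntegral.integral_pos (by linarith) (hcont' _).continuousOn
        (fun t ht => (hpos t (hs.trans ht.1.le)).le)
        ⟨s, ⟨le_rfl, by linarith⟩, hpos s hs⟩
    rw [hint _ s (s + T) hs (by linarith [h.pos])] at h1
    have h2 : 0 ≤ Real.exp (K * s) * mass (ℓ s) Λ (Function.update τ x i) :=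
      mul_nonneg (Real.exp_pos _).le (h.mass_nonneg _ _ _)
    have h3 : 0 < Real.exp (K * (s + T)) * mass (ℓ (s + T)) Λ (Function.update τ x i) := by
      linarith
    -- Positivity was obtained at time `s + T`; periodicity brings it back to time `s`.
    rw [h.periodic s hs] at h3
    exact pos_of_mul_pos_right h3 (Real.exp_pos _).le
  obtain ⟨τ, hτ⟩ : ∃ τ, 0 < mass (ℓ 0) Λ τ := by
    by_contra! hne
    have h1 := h.sum_mass 0 Λ
    have h2 : ∑ τ, mass (ℓ 0) Λ τ ≤ 0 := Finset.sum_nonpos fun τ _ => hne τ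
    linarith
  have hQ : Q τ := by
    intro s hs
    by_cases hΛ : Nonempty Λ
    · obtain ⟨x⟩ := hΛ
      have h1 : 0 ≤ ∫ t in (0 : ℝ)..s, Real.exp (K * t) * (K * mass (ℓ t) Λ τ +
          flux (jump hc (ℓ t) Λ) (Pi.single τ 1)) := by
        refine intervalIntegral.integral_nonneg hs fun t _ => mul_nonneg (Real.exp_pos _).le ?_
        have := hlow τ x (τ x) t
        rw [Function.update_eq_self] at this
        exact (mul_nonneg hκ0.le (h.mass_nonneg _ _ _)).trans this
      rw [hint τ 0 s le_rfl hs] at h1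
      simp only [mul_zero, Real.exp_zero, one_mul] at h1
      have h2 : 0 < Real.exp (K * s) * mass (ℓ s) Λ τ := by linarith
      exact pos_of_mul_pos_right h2 (Real.exp_pos _).le
    · rw [not_nonempty_iff] at hΛ
      have h1 := h.sum_mass s Λ
      rw [Fintype.sum_unique] at h1
      rw [Subsingleton.elim τ default, h1]
      exact one_pos
  exact forall_of_update hstep hQ σ s hs

/-- The quotient is the conditional mean of the rate given `σ`, hence as close to `a` as the rate
itself is on the cylinder. -/
theorem abs_jump_div_sub_le (h : IsPeriodicFlow hc T ℓ) {Λ : Finset (Site d)} {σ : Λ → Fin q}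
    {s : ℝ} (hs : 0 ≤ s) (x : Λ) (i : Fin q) {δ a : ℝ}
    (hδ : ∀ η : Config d q, Λ.restrict η = σ → |c x η i - a| ≤ δ) :
    |jump hc (ℓ s) Λ σ x i / mass (ℓ s) Λ σ - a| ≤ δ := by
  have hp := h.mass_pos Λ σ hs
  have h1 := h.mul_mass_le_jump s Λ σ x i (κ := a - δ) fun η hη => by
    have := (abs_le.1 (hδ η hη)).1
    linarith
  have h2 := h.jump_le_mul_mass s Λ σ x i (K := a + δ) fun η hη => by
    have := (abs_le.1 (hδ η hη)).2
    linarith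
  rw [abs_le]
  constructor
  · have := (le_div_iff₀ hp).2 h1
    linarith
  · have := (div_le_iff₀ hp).2 h2
    linarith

theorem continuousOn_log (h : IsPeriodicFlow hc T ℓ) {Λ : Finset (Site d)} {m : (Λ → Fin q) → ℝ}
    (hm : ∀ σ, 0 < m σ) (σ : Λ → Fin q) :
    ContinuousOn (fun s => Real.log (mass (ℓ s) Λ σ / m σ)) (Set.Ici 0) :=
  ((h.continuous_mass Λ σ).div_const _).continuousOn.log fun _ hs =>
    (div_pos (h.mass_pos Λ σ hs) (hm σ)).ne'

theorem continuousOn_dissipation (h : IsPeriodicFlow hc T ℓ) {Λ : Finset (Site d)}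
    {m : (Λ → Fin q) → ℝ} (hm : ∀ σ, 0 < m σ) (x : Λ) :
    ContinuousOn (fun s => dissipation (mass (ℓ s) Λ) m x) (Set.Ici 0) := by
  refine continuousOn_finsetSum _ fun i _ => continuousOn_finsetSum _ fun σ _ =>
    (h.continuous_mass Λ σ).continuousOn.mul ?_
  have h1 : ContinuousOn (fun s => mass (ℓ s) Λ (Function.update σ x i) /
      m (Function.update σ x i) / (mass (ℓ s) Λ σ / m σ)) (Set.Ici 0) :=
    ((h.continuous_mass Λ _).div_const _).continuousOn.div
      ((h.continuous_mass Λ _).div_const _).continuousOn fun _ hs =>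
        (div_pos (h.mass_pos Λ σ hs) (hm σ)).ne'
  exact (h1.sub continuousOn_const).sub (h1.log fun _ hs =>
    (div_pos (div_pos (h.mass_pos Λ _ hs) (hm _)) (div_pos (h.mass_pos Λ σ hs) (hm σ))).ne')

theorem continuousOn_flux_log (h : IsPeriodicFlow hc T ℓ) {Λ : Finset (Site d)}
    {m : (Λ → Fin q) → ℝ} (hm : ∀ σ, 0 < m σ) :
    ContinuousOn (fun s => flux (jump hc (ℓ s) Λ) fun σ => Real.log (mass (ℓ s) Λ σ / m σ))
      (Set.Ici 0) := by
  refine continuousOn_finsetSum _ fun σ _ => continuousOn_finsetSum _ fun x _ =>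
    continuousOn_finsetSum _ fun i _ => (h.continuous_jump Λ σ x i).continuousOn.mul ?_
  exact (h.continuousOn_log hm _).sub (h.continuousOn_log hm _)

/-- Over a period the relative entropy returns to its initial value. -/
theorem integral_flux_log (h : IsPeriodicFlow hc T ℓ) {Λ : Finset (Site d)}
    {m : (Λ → Fin q) → ℝ} (hm : ∀ σ, 0 < m σ) :
    ∫ s in (0 : ℝ)..T, (flux (jump hc (ℓ s) Λ) fun σ => Real.log (mass (ℓ s) Λ σ / m σ)) = 0 := by
  have hsub : Set.Icc 0 T ⊆ Set.Ici (0 : ℝ) := fun s hs => hs.1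
  have hderiv : ∀ s ∈ Set.Ioo 0 T, HasDerivWithinAt
      (fun s => ∑ σ, mass (ℓ s) Λ σ * Real.log (mass (ℓ s) Λ σ / m σ))
      (flux (jump hc (ℓ s) Λ) fun σ => Real.log (mass (ℓ s) Λ σ / m σ)) (Set.Ioi s) s := by
    intro s hs
    have hp := fun σ => h.mass_pos Λ σ hs.1.le
    have h1 := HasDerivWithinAt.fun_sum (u := Finset.univ) fun σ (_ : σ ∈ Finset.univ) =>
      (h.hasDerivWithinAt_mass Λ σ hs.1.le).mul
        (((h.hasDerivWithinAt_mass Λ σ hs.1.le).div_const (m σ)).log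
          (div_pos (hp σ) (hm σ)).ne')
    refine h1.congr_deriv ?_
    rw [← flux_sum_mul, Finset.sum_add_distrib, add_eq_left]
    -- Differentiating the logarithm leaves the sum of the derivatives of the masses, which is zero
    -- because the flux of a constant vanishes.
    have h2 : ∀ σ, mass (ℓ s) Λ σ * (flux (jump hc (ℓ s) Λ) (Pi.single σ 1) / m σ /
        (mass (ℓ s) Λ σ / m σ)) = flux (jump hc (ℓ s) Λ) (Pi.single σ 1) * 1 := fun σ => by
      have := (hp σ).ne'
      have := (hm σ).ne'
      field_simp
    rw [Finset.sum_congr rfl fun σ _ => h2 σ, flux_sum_mul _ fun _ => 1]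
    simp [flux]
  rw [intervalIntegral.integral_eq_sub_of_hasDeriv_right_of_le h.pos.le ?_ hderiv]
  · have := h.periodic 0 le_rfl
    rw [zero_add] at this
    rw [this, sub_self]
  · exact ((h.continuousOn_flux_log hm).mono (by rwa [Set.uIcc_of_le h.pos.le])).intervalIntegrable
  · exact continuousOn_finsetSum _ fun σ _ => (h.continuous_mass Λ σ).continuousOn.mul
      ((h.continuousOn_log hm σ).mono hsub)

/-- The dissipation over a period is bounded by the influence of the outside of `Λ`. -/
theorem integral_dissipation_le (h : IsPeriodicFlow hc T ℓ) {T' : ℝ}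
    {ℓ' : ℝ → C(Config d q, ℝ) →L[ℝ] ℝ} (h' : IsPeriodicFlow hc T' ℓ') (hstat : ∀ Λ f, ℓ' 0 (cylGen hc Λ f) = 0) {κ : ℝ}
    (hκ : ∀ x η i, κ ≤ c x η i) (Λ : Finset (Site d)) {δ : Site d → ℝ} (hδ0 : ∀ x, 0 ≤ δ x)
    (hδ : ∀ x ∈ Λ, ∀ i, ∀ η ξ : Config d q, η x ≠ i → Λ.restrict η = Λ.restrict ξ →
      |c x η i - c x ξ i| ≤ δ x) {l : ℝ} (hl : 0 < l) :
    κ * ∑ x : Λ, ∫ s in (0 : ℝ)..T, dissipation (mass (ℓ s) Λ) (mass (ℓ' 0) Λ) x ≤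
      ∑ x : Λ, 2 * δ x * (l * ∫ s in (0 : ℝ)..T, dissipation (mass (ℓ s) Λ) (mass (ℓ' 0) Λ) x) +
        l⁻¹ * (q * T * ∑ x : Λ, 2 * δ x) := by
  have hm : ∀ σ, 0 < mass (ℓ' 0) Λ σ := fun σ => h'.mass_pos Λ σ le_rfl
  have hpt : ∀ s ∈ Set.Icc 0 T,
      (flux (jump hc (ℓ s) Λ) fun σ => Real.log (mass (ℓ s) Λ σ / mass (ℓ' 0) Λ σ)) ≤
      -κ * ∑ x, dissipation (mass (ℓ s) Λ) (mass (ℓ' 0) Λ) x +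
      ∑ x : Λ, 2 * δ x * (l * dissipation (mass (ℓ s) Λ) (mass (ℓ' 0) Λ) x +
        l⁻¹ * Fintype.card (Fin q)) := by
    intro s hs
    refine flux_log_le (s := jump hc (ℓ' 0) Λ) (ε := fun x : Λ => 2 * δ x)
      (fun σ => h.mass_pos Λ σ hs.1) hm (h.sum_mass s Λ)
      (fun f => by rw [← map_cylGen]; exact hstat Λ f)
      (fun σ x i => h.mul_mass_le_jump s Λ σ x i fun η _ => hκ _ _ _)
      (fun σ x i => h'.mul_mass_le_jump 0 Λ σ x i fun η _ => hκ _ _ _)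
      (fun x => by have := hδ0 x; positivity) ?_ hl
    intro σ x i hσ
    classical
    -- An extension of `σ` with arbitrary values outside `Λ`. Both conditional rates are compared
    -- with the rate at `ξ`, whence the factor 2 in `2 * δ x`.
    let ξ : Config d q := fun y => if hy : y ∈ Λ then σ ⟨y, hy⟩ else i
    have hξ : Λ.restrict ξ = σ := by
      ext y
      simp [ξ]
    have hξη : ∀ η : Config d q, Λ.restrict η = σ → |c x η i - c x ξ i| ≤ δ x := by
      intro η hη
      refine hδ x x.2 i η ξ ?_ (hη.trans hξ.symm)
      rw [← hη] at hσ
      exact hσ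
    have h1 := h.abs_jump_div_sub_le hs.1 x i hξη
    have h2 := h'.abs_jump_div_sub_le le_rfl x i hξη
    rw [abs_sub_comm] at h2
    have h3 := abs_add_le (jump hc (ℓ s) Λ σ x i / mass (ℓ s) Λ σ - c x ξ i)
      (c x ξ i - jump hc (ℓ' 0) Λ σ x i / mass (ℓ' 0) Λ σ)
    rw [sub_add_sub_cancel] at h3
    linarith
  have huIcc : Set.uIcc 0 T ⊆ Set.Ici (0 : ℝ) := by
    rw [Set.uIcc_of_le h.pos.le]
    exact fun s hs => hs.1
  have hid : ∀ x : Λ, IntervalIntegrable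
      (fun s => dissipation (mass (ℓ s) Λ) (mass (ℓ' 0) Λ) x) volume 0 T := fun x =>
    ((h.continuousOn_dissipation hm x).mono huIcc).intervalIntegrable
  have hi1 : IntervalIntegrable (fun s => -κ * ∑ x, dissipation (mass (ℓ s) Λ) (mass (ℓ' 0) Λ) x)
      volume 0 T := by
    refine IntervalIntegrable.const_mul ?_ _
    simpa [Finset.sum_fn] using IntervalIntegrable.sum Finset.univ fun x _ => hid x
  have hi2 : ∀ x : Λ, IntervalIntegrable (fun s => 2 * δ x *
      (l * dissipation (mass (ℓ s) Λ) (mass (ℓ' 0) Λ) x + l⁻¹ * Fintype.card (Fin q)))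
      volume 0 T := fun x =>
    (((hid x).const_mul l).add intervalIntegrable_const).const_mul _
  have hi3 : IntervalIntegrable (fun s => ∑ x : Λ, 2 * δ x *
      (l * dissipation (mass (ℓ s) Λ) (mass (ℓ' 0) Λ) x + l⁻¹ * Fintype.card (Fin q)))
      volume 0 T := by
    simpa [Finset.sum_fn] using IntervalIntegrable.sum Finset.univ fun x _ => hi2 x
  have hmono := intervalIntegral.integral_mono_on h.pos.le
    ((h.continuousOn_flux_log hm).mono huIcc).intervalIntegrable (hi1.add hi3) hpt
  rw [h.integral_flux_log hm, intervalIntegral.integral_add hi1 hi3,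
    intervalIntegral.integral_const_mul,
    intervalIntegral.integral_finsetSum (fun x _ => hid x),
    intervalIntegral.integral_finsetSum (fun x _ => hi2 x)] at hmono
  have h4 : ∀ x : Λ, ∫ s in (0 : ℝ)..T, 2 * δ x *
      (l * dissipation (mass (ℓ s) Λ) (mass (ℓ' 0) Λ) x + l⁻¹ * Fintype.card (Fin q)) =
      2 * δ x * (l * ∫ s in (0 : ℝ)..T, dissipation (mass (ℓ s) Λ) (mass (ℓ' 0) Λ) x) +
        l⁻¹ * (q * T * (2 * δ x)) := by
    intro x
    rw [intervalIntegral.integral_const_mul, intervalIntegral.integral_add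
      ((hid x).const_mul l) intervalIntegrable_const, intervalIntegral.integral_const_mul,
      intervalIntegral.integral_const]
    simp
    ring
  rw [Finset.sum_congr rfl fun x _ => h4 x, Finset.sum_add_distrib, ← Finset.mul_sum,
    ← Finset.mul_sum] at hmono
  linarith

end IsPeriodicFlow

end Flow

/-! ### Boxes in the lattice -/

section Lattice

variable {d : ℕ}

/-- The maximum norm on the lattice as a natural number. -/
def supNorm (x : Site d) : ℕ := Finset.univ.sup fun i => (x i).natAbs

theorem supNorm_le {x : Site d} {n : ℕ} : supNorm x ≤ n ↔ ∀ i, (x i).natAbs ≤ n := by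
  simp [supNorm]

theorem supNorm_add_le (x y : Site d) : supNorm (x + y) ≤ supNorm x + supNorm y := by
  rw [supNorm_le]
  intro i
  have h1 := supNorm_le.1 (le_refl (supNorm x)) i
  have h2 := supNorm_le.1 (le_refl (supNorm y)) i
  have := Int.natAbs_add_le (x i) (y i)
  simp only [Pi.add_apply]
  omega

theorem supNorm_le_enorm (x : Site d) : (supNorm x : ℝ≥0∞) ≤ ‖x‖ₑ := by
  rcases isEmpty_or_nonempty (Fin d) with h | h
  · simp [supNorm]
  · obtain ⟨i, _, hi⟩ := Finset.exists_mem_eq_sup (Finset.univ : Finset (Fin d))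
      Finset.univ_nonempty fun i => (x i).natAbs
    have h1 : ((supNorm x : ℕ) : ℝ≥0) ≤ ‖x‖₊ := by
      rw [supNorm, hi, NNReal.natCast_natAbs]
      exact nnnorm_le_pi_nnnorm x i
    rw [enorm_eq_nnnorm]
    exact_mod_cast h1

variable (d) in
/-- The box of radius `n` around the origin. -/
noncomputable def box (n : ℕ) : Finset (Site d) := Finset.Icc (fun _ => -(n : ℤ)) (fun _ => n)

theorem mem_box {x : Site d} {n : ℕ} : x ∈ box d n ↔ supNorm x ≤ n := by
  rw [supNorm_le, box, Finset.mem_Icc, Pi.le_def, Pi.le_def, ← forall_and]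
  refine forall_congr' fun i => ?_
  omega

theorem box_mono : Monotone (box d) := fun _ _ h _ hx => mem_box.2 ((mem_box.1 hx).trans h)

theorem card_box (n : ℕ) : (box d n).card = (2 * n + 1) ^ d := by
  rw [box, Pi.card_Icc]
  simp only [Int.card_Icc, Finset.prod_const, Finset.card_univ, Fintype.card_fin]
  congr 1
  omega

/-- The sites at distance `n` from the origin. -/
noncomputable def sphere (d n : ℕ) : Finset (Site d) := {x ∈ box d n | supNorm x = n}

theorem mem_sphere {x : Site d} {n : ℕ} : x ∈ sphere d n ↔ supNorm x = n := by
  rw [sphere, Finset.mem_filter, mem_box]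
  exact ⟨fun h => h.2, fun h => ⟨h.le, h⟩⟩

/-- The dimension enters only here: linear growth of the spheres is what leaves the weights `1 / (n
+ 1)` of the harmonic series. -/
theorem card_sphere_le (hd : d = 1 ∨ d = 2) (n : ℕ) : (sphere d n).card ≤ 8 * (n + 1) := by
  rcases n with _ | n
  · refine (Finset.card_le_card (Finset.filter_subset _ _)).trans ?_
    rw [card_box]
    simp
  · have h1 : sphere d (n + 1) ⊆ box d (n + 1) \ box d n := by
      intro x hx
      rw [mem_sphere] at hx
      rw [Finset.mem_sdiff, mem_box, mem_box]
      omega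
    refine (Finset.card_le_card h1).trans ?_
    rw [Finset.card_sdiff_of_subset (box_mono (Nat.le_add_right n 1)), card_box, card_box]
    rcases hd with rfl | rfl
    · rw [pow_one, pow_one]
      omega
    · have : (2 * (n + 1) + 1) ^ 2 = (2 * n + 1) ^ 2 + 8 * (n + 1) := by ring
      omega

theorem sum_box_eq {M : Type*} [AddCommMonoid M] (f : Site d → M) (n : ℕ) :
    ∑ x ∈ box d n, f x = ∑ m ∈ Finset.range (n + 1), ∑ x ∈ sphere d m, f x := by
  rw [← Finset.sum_fiberwise_of_maps_to (g := supNorm) (t := Finset.range (n + 1))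
    (fun x hx => Finset.mem_range.2 (Nat.lt_succ_of_le (mem_box.1 hx)))]
  refine Finset.sum_congr rfl fun m hm => Finset.sum_congr ?_ fun _ _ => rfl
  ext x
  rw [Finset.mem_filter, mem_sphere, mem_box]
  rw [Finset.mem_range] at hm
  omega

end Lattice

/-! ### The influence of distant spins on the rates -/

section Influence

variable {d q : ℕ}

/-- Change `η` into `ξ` one spin at a time; sites of `Λ` cost nothing, and continuity of `f` passes
to infinitely many changes. -/
theorem enorm_sub_le_tsum_osc {f : Config d q → ℝ} (hf : Continuous f) {Λ : Finset (Site d)}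
    {η ξ : Config d q} (h : Λ.restrict η = Λ.restrict ξ) :
    ‖f ξ - f η‖ₑ ≤ ∑' z, if z ∈ Λ then 0 else osc z f := by
  have hF : ∀ F : Finset (Site d), ‖f (F.piecewise ξ η) - f η‖ₑ ≤
      ∑ z ∈ F, if z ∈ Λ then 0 else osc z f := by
    intro F
    induction F using Finset.induction_on with
    | empty => simp
    | insert a F ha ih =>
      rw [Finset.sum_insert ha, Finset.piecewise_insert]
      by_cases haΛ : a ∈ Λ
      · have h1 : ξ a = F.piecewise ξ η a := by
          rw [Finset.piecewise_eq_of_notMem _ _ _ ha]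
          exact (congrFun h ⟨a, haΛ⟩).symm
        rw [h1, Function.update_eq_self, if_pos haΛ, zero_add]
        exact ih
      · rw [if_neg haΛ, ← sub_add_sub_cancel _ (f (F.piecewise ξ η))]
        refine (enorm_add_le _ _).trans (add_le_add ?_ ih)
        refine le_iSup_of_le _ (le_iSup_of_le _ (le_iSup_of_le ?_ le_rfl))
        intro z hz
        simp [hz]
  have hlim : Tendsto (fun F : Finset (Site d) => F.piecewise ξ η) atTop (𝓝 ξ) := by
    rw [tendsto_pi_nhds]
    intro z
    refine tendsto_const_nhds.congr' ?_
    filter_upwards [eventually_ge_atTop {z}] with F hz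
    rw [Finset.piecewise_eq_of_mem]
    exact hz (Finset.mem_singleton_self z)
  have hlim2 : Tendsto (fun F : Finset (Site d) => ‖f (F.piecewise ξ η) - f η‖ₑ) atTop
      (𝓝 ‖f ξ - f η‖ₑ) :=
    (continuous_enorm.tendsto _).comp ((((hf.tendsto ξ).comp hlim)).sub_const _)
  exact le_of_tendsto hlim2 (Eventually.of_forall fun F => (hF F).trans (ENNReal.sum_le_tsum F))

variable {c : Rates d q}

theorem continuous_jumpRate (hc : RateConditions c) (x : Site d) (i : Fin q) :
    Continuous (jumpRate c x i) := by
  have h1 : IsClopen {η : Config d q | η x = i} :=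
    (isClopen_discrete {i}).preimage (continuous_apply x)
  exact continuous_const.if (fun η hη => by simp [h1.frontier_eq] at hη) (hc.continuous x i)

/-- The largest influence of a spin on the rates at the site that sees it in the direction `y`. -/
noncomputable def influence (c : Rates d q) (y : Site d) : ℝ≥0∞ :=
  ⨆ x : Site d, ∑ i : Fin q, osc (x + y) (jumpRate c x i)

/-- The total influence from distances larger than `k`. -/
noncomputable def influenceTail (c : Rates d q) (k : ℕ) : ℝ≥0∞ :=
  ∑' y : Site d, if k + 1 ≤ supNorm y then influence c y else 0

/-- The direction `y` is counted once for every `k` below its norm, which is how the first moment of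
the influence arises. -/
theorem sum_influenceTail_le (K : ℕ) :
    ∑ k ∈ Finset.range K, influenceTail c k ≤ ∑' y : Site d, ‖y‖ₑ * influence c y := by
  simp only [influenceTail]
  rw [← Summable.tsum_finsetSum fun _ _ => ENNReal.summable]
  refine ENNReal.tsum_le_tsum fun y => ?_
  rw [← Finset.sum_filter, Finset.sum_const, nsmul_eq_mul]
  refine mul_le_mul_left ((Nat.cast_le.2 ?_).trans (supNorm_le_enorm y)) _
  have : Finset.filter (fun k => k + 1 ≤ supNorm y) (Finset.range K) ⊆
      Finset.range (supNorm y) := by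
    intro k hk
    rw [Finset.mem_filter] at hk
    exact Finset.mem_range.2 hk.2
  simpa using Finset.card_le_card this

theorem influenceTail_lt_top (hc : RateConditions c) (k : ℕ) : influenceTail c k < ⊤ := by
  refine lt_of_le_of_lt ?_ hc.short_range
  refine le_trans ?_ (sum_influenceTail_le (c := c) (k + 1))
  exact Finset.single_le_sum (f := influenceTail c) (fun _ _ => zero_le) (by simp)

theorem antitone_influenceTail : Antitone (influenceTail c) := by
  intro k l hkl
  refine ENNReal.tsum_le_tsum fun y => ?_
  split_ifs with h1 h2
  · rfl
  · omega
  · exact zero_le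
  · rfl

theorem antitone_toReal_influenceTail (hc : RateConditions c) :
    Antitone fun k => (influenceTail c k).toReal := fun _ _ h =>
  ENNReal.toReal_mono (influenceTail_lt_top hc _).ne (antitone_influenceTail h)

theorem sum_toReal_influenceTail_le (hc : RateConditions c) (K : ℕ) :
    ∑ k ∈ Finset.range K, (influenceTail c k).toReal ≤
      (∑' y : Site d, ‖y‖ₑ * influence c y).toReal := by
  rw [← ENNReal.toReal_sum fun k _ => (influenceTail_lt_top hc k).ne]
  exact ENNReal.toReal_mono hc.short_range.ne (sum_influenceTail_le K)

/-- A spin outside the box of radius `n` is at distance at least `n - supNorm x + 1` from `x`. Since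
`η` and `ξ` agree at `x`, both rates belong to genuine jumps and equal `jumpRate`. -/
theorem abs_rate_sub_le (hc : RateConditions c) {n : ℕ} {x : Site d} (hx : x ∈ box d n) (i : Fin q)
    {η ξ : Config d q} (hi : η x ≠ i) (h : (box d n).restrict η = (box d n).restrict ξ) :
    |c x η i - c x ξ i| ≤ (influenceTail c (n - supNorm x)).toReal := by
  have hxi : ξ x ≠ i := by
    have : η x = ξ x := congrFun h ⟨x, hx⟩
    rwa [← this]
  have h1 := enorm_sub_le_tsum_osc (continuous_jumpRate hc x i) h.symm
  have h2 : ∑' z, (if z ∈ box d n then 0 else osc z (jumpRate c x i)) =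
      ∑' y, if x + y ∈ box d n then 0 else osc (x + y) (jumpRate c x i) :=
    ((Equiv.addLeft x).tsum_eq fun z => if z ∈ box d n then 0 else osc z (jumpRate c x i)).symm
  rw [h2] at h1
  simp only [jumpRate, hi, hxi, if_false] at h1
  rw [← Real.norm_eq_abs, ← toReal_enorm]
  refine ENNReal.toReal_mono (influenceTail_lt_top hc _).ne (h1.trans ?_)
  refine ENNReal.tsum_le_tsum fun y => ?_
  have h2 := supNorm_add_le x y
  split_ifs with h3 h4
  · exact zero_le
  · exact zero_le
  · exact (Finset.single_le_sum (f := fun i => osc (x + y) (jumpRate c x i))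
      (fun _ _ => zero_le) (Finset.mem_univ i)).trans
      (le_iSup (fun x => ∑ i : Fin q, osc (x + y) (jumpRate c x i)) x)
  · rw [mem_box] at h3 hx
    omega

end Influence

/-! ### Uniqueness of periodic flows -/

section Uniqueness

variable {d q : ℕ} {c : Rates d q} {hc : RateConditions c} {T T' : ℝ}
  {ℓ ℓ' : ℝ → C(Config d q, ℝ) →L[ℝ] ℝ}

/-- The quadratic `l² e - l a + f` is nonnegative, so its discriminant is not positive. This needs
no case distinction when `e` or `f` is zero. -/
theorem sq_le_of_forall_le_mul_add {a e f : ℝ} (ha : 0 ≤ a) (he : 0 ≤ e) (hf : 0 ≤ f)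
    (h : ∀ l, 0 < l → a ≤ l * e + l⁻¹ * f) : a ^ 2 ≤ 4 * e * f := by
  have h1 : discrim e (-a) f ≤ 0 := by
    refine discrim_le_zero fun x => ?_
    rcases le_or_gt x 0 with hx | hx
    · have : 0 ≤ a * -x := mul_nonneg ha (by linarith)
      have : 0 ≤ e * (x * x) := mul_nonneg he (mul_self_nonneg x)
      linarith
    · have h2 := mul_le_mul_of_nonneg_left (h x hx) hx.le
      have h3 : x * (x * e + x⁻¹ * f) = e * (x * x) + f := by field_simp
      linarith
  unfold discrim at h1
  linarith

theorem mass_eq_sum (ℓ : C(Config d q, ℝ) →L[ℝ] ℝ) {Λ Λ' : Finset (Site d)} (hΛ : Λ ⊆ Λ')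
    (σ : Λ → Fin q) : mass ℓ Λ σ =
      ∑ τ with τ ∘ (fun x : Λ => (⟨x, hΛ x.2⟩ : Λ')) = σ, mass ℓ Λ' τ := by
  have h1 : cylFun Λ (Pi.single σ 1) = cylFun Λ' fun τ : Λ' → Fin q =>
      (Pi.single σ 1 : (Λ → Fin q) → ℝ) (τ ∘ fun x : Λ => (⟨x, hΛ x.2⟩ : Λ')) := rfl
  rw [mass, h1, map_cylFun, Finset.sum_filter]
  refine Finset.sum_congr rfl fun τ _ => ?_
  rw [Pi.single_apply]
  split_ifs <;> simp

/-- The dissipation at `x` in the box of radius `n` over the time `T`. -/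
noncomputable def boxDissipation (ℓ : ℝ → C(Config d q, ℝ) →L[ℝ] ℝ)
    (ℓ₀ : C(Config d q, ℝ) →L[ℝ] ℝ) (T : ℝ) (n : ℕ) (x : Site d) : ℝ :=
  if h : x ∈ box d n then
    ∫ s in (0 : ℝ)..T, dissipation (mass (ℓ s) (box d n)) (mass ℓ₀ (box d n)) ⟨x, h⟩
  else 0

namespace IsPeriodicFlow

theorem boxDissipation_nonneg (h : IsPeriodicFlow hc T ℓ) (h' : IsPeriodicFlow hc T' ℓ')
    (n : ℕ) (x : Site d) : 0 ≤ boxDissipation ℓ (ℓ' 0) T n x := by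
  unfold boxDissipation
  split_ifs with hx
  · exact intervalIntegral.integral_nonneg h.pos.le fun s hs =>
      dissipation_nonneg (fun σ => h.mass_pos _ σ hs.1) (fun σ => h'.mass_pos _ σ le_rfl) _
  · exact le_rfl

theorem boxDissipation_mono (h : IsPeriodicFlow hc T ℓ) (h' : IsPeriodicFlow hc T' ℓ')
    {w : Site d → Fin q → Fin q → ℝ}
    (hw : ∀ (Λ : Finset (Site d)) σ (x : Λ) i,
      mass (ℓ' 0) Λ σ = w x (σ x) i * mass (ℓ' 0) Λ (Function.update σ x i))
    {k n : ℕ} (hkn : k ≤ n) {x : Site d} (hx : x ∈ box d k) :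
    boxDissipation ℓ (ℓ' 0) T k x ≤ boxDissipation ℓ (ℓ' 0) T n x := by
  have hsub : box d k ⊆ box d n := box_mono hkn
  have hm : ∀ n σ, 0 < mass (ℓ' 0) (box d n) σ := fun n σ => h'.mass_pos _ σ le_rfl
  rw [boxDissipation, boxDissipation, dif_pos hx, dif_pos (hsub hx)]
  have huIcc : Set.uIcc 0 T ⊆ Set.Ici (0 : ℝ) := by
    rw [Set.uIcc_of_le h.pos.le]
    exact fun s hs => hs.1
  refine intervalIntegral.integral_mono_on h.pos.le
    ((h.continuousOn_dissipation (hm k) _).mono huIcc).intervalIntegrable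
    ((h.continuousOn_dissipation (hm n) _).mono huIcc).intervalIntegrable fun s hs => ?_
  exact dissipation_le (fun x : box d k => (⟨x, hsub x.2⟩ : box d n))
    (fun x y hxy => Subtype.ext (Subtype.mk.inj hxy))
    (fun σ => h.mass_pos _ σ hs.1) (hm k) (hm n) (fun σ => mass_eq_sum (ℓ s) hsub σ) ⟨x, hx⟩
    (w x) (fun σ i => hw _ σ ⟨x, hx⟩ i) (fun τ i => hw _ τ ⟨x, hsub hx⟩ i)

theorem boxDissipation_eq_zero (hd : d = 1 ∨ d = 2)
    (h : IsPeriodicFlow hc T ℓ) (h' : IsPeriodicFlow hc T' ℓ')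
    (hstat : ∀ Λ f, ℓ' 0 (cylGen hc Λ f) = 0) {w : Site d → Fin q → Fin q → ℝ}
    (hw : ∀ (Λ : Finset (Site d)) σ (x : Λ) i,
      mass (ℓ' 0) Λ σ = w x (σ x) i * mass (ℓ' 0) Λ (Function.update σ x i))
    (n : ℕ) (x : Site d) : boxDissipation ℓ (ℓ' 0) T n x = 0 := by
  obtain ⟨κ, hκ0, hκ⟩ := hc.bounded_below
  set A : ℕ → Site d → ℝ := boxDissipation ℓ (ℓ' 0) T with hA
  have hA0 : ∀ n x, 0 ≤ A n x := h.boxDissipation_nonneg h'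
  set b : ℕ → ℝ := fun k => (influenceTail c k).toReal with hb
  have hb0 : ∀ k, 0 ≤ b k := fun k => ENNReal.toReal_nonneg
  set B : ℝ := (∑' y : Site d, ‖y‖ₑ * influence c y).toReal
  have hB : ∀ K, ∑ k ∈ Finset.range K, b k ≤ B := sum_toReal_influenceTail_le hc
  set α : ℕ → ℝ := fun n => ∑ x ∈ box d n, A n x with hαdef
  set S : ℕ → ℕ → ℝ := fun n m => ∑ x ∈ sphere d m, A n x
  have hα : ∀ n, α n = ∑ m ∈ Finset.range (n + 1), S n m := fun n => sum_box_eq _ n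
  have hS0 : ∀ n m, 0 ≤ S n m := fun n m => Finset.sum_nonneg fun x _ => hA0 n x
  have hα0 : ∀ n, 0 ≤ α n := fun n => Finset.sum_nonneg fun x _ => hA0 n x
  have hmono : ∀ k n, k ≤ n → α k ≤ ∑ m ∈ Finset.range (k + 1), S n m := by
    intro k n hkn
    rw [← sum_box_eq]
    exact Finset.sum_le_sum fun x hx => h.boxDissipation_mono h' hw hkn hx
  have hαmono : Monotone α := fun k n hkn => by
    refine (hmono k n hkn).trans ?_
    rw [hα]
    exact Finset.sum_le_sum_of_subset_of_nonneg (Finset.range_mono (by omega))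
      fun m _ _ => hS0 n m
  have hbd := sum_boundary_le (antitone_toReal_influenceTail hc) hB hα hmono hαmono (hα0 0)
  have hE : ∀ n, ∑ x ∈ box d n, b (n - supNorm x) * A n x =
      ∑ m ∈ Finset.range (n + 1), b (n - m) * S n m := by
    intro n
    rw [sum_box_eq]
    refine Finset.sum_congr rfl fun m _ => ?_
    rw [Finset.mul_sum]
    exact Finset.sum_congr rfl fun x hx => by rw [mem_sphere.1 hx]
  -- Each sphere inside the box has at most `8 * (n + 1)` sites, and the weights `b (n - m)` sum to
  -- at most `B`.
  have hF : ∀ n : ℕ, ∑ x ∈ box d n, b (n - supNorm x) ≤ 8 * (n + 1) * B := by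
    intro n
    rw [sum_box_eq]
    calc ∑ m ∈ Finset.range (n + 1), ∑ x ∈ sphere d m, b (n - supNorm x)
        ≤ ∑ m ∈ Finset.range (n + 1), 8 * (n + 1) * b (n - m) := by
          refine Finset.sum_le_sum fun m hm => ?_
          rw [Finset.sum_congr rfl fun x hx => by rw [mem_sphere.1 hx], Finset.sum_const,
            nsmul_eq_mul]
          refine mul_le_mul_of_nonneg_right ?_ (hb0 _)
          have h1 := card_sphere_le hd m
          have h2 : m + 1 ≤ n + 1 := Finset.mem_range.1 hm
          have h3 : (sphere d m).card ≤ 8 * (n + 1) := h1.trans (by omega)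
          exact_mod_cast h3
      _ = 8 * (n + 1) * ∑ m ∈ Finset.range (n + 1), b m := by
          rw [← Finset.mul_sum, ← Finset.sum_range_reflect b]
          simp
      _ ≤ 8 * (n + 1) * B := by
          refine mul_le_mul_of_nonneg_left (hB _) (by positivity)
  have hB0 : 0 ≤ B := ENNReal.toReal_nonneg
  have hT := h.pos
  -- The constant is 128 = 4 · 2 · 2 · 8: the discriminant, the two factors in `2 * δ`, and the
  -- sphere count.
  have hsq : ∀ n : ℕ, α n ^ 2 / (n + 1) ≤ 128 * q * T * B / κ ^ 2 *
      ∑ m ∈ Finset.range (n + 1), b (n - m) * S n m := by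
    intro n
    set E := ∑ m ∈ Finset.range (n + 1), b (n - m) * S n m with hEdef
    set F := ∑ x ∈ box d n, b (n - supNorm x) with hFdef
    have hE0 : 0 ≤ E := Finset.sum_nonneg fun m _ => mul_nonneg (hb0 _) (hS0 _ _)
    have hF0 : 0 ≤ F := Finset.sum_nonneg fun x _ => hb0 _
    have hle : ∀ l, 0 < l → κ * α n ≤ l * (2 * E) + l⁻¹ * (q * T * (2 * F)) := by
      intro l hl
      have h1 := h.integral_dissipation_le h' hstat hκ (box d n)
        (δ := fun x => b (n - supNorm x)) (fun x => hb0 _)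
        (fun x hx i η ξ hi hηξ => abs_rate_sub_le hc hx i hi hηξ) hl
      have hAx : ∀ x : box d n, ∫ s in (0 : ℝ)..T, dissipation (mass (ℓ s) (box d n))
          (mass (ℓ' 0) (box d n)) x = A n x := fun x => by
        rw [hA, boxDissipation, dif_pos x.2]
      simp only [hAx] at h1
      rw [Finset.sum_coe_sort (box d n) (fun x => A n x),
        Finset.sum_coe_sort (box d n) (fun x => 2 * b (n - supNorm x) * (l * A n x)),
        Finset.sum_coe_sort (box d n) (fun x => 2 * b (n - supNorm x))] at h1
      refine h1.trans (le_of_eq ?_)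
      rw [hFdef, hEdef, ← hE n]
      simp only [Finset.mul_sum]
      congr 1
      exact Finset.sum_congr rfl fun x _ => by ring
    have h2 := sq_le_of_forall_le_mul_add (mul_nonneg hκ0.le (hα0 n)) (by positivity)
      (by positivity) hle
    have h3 : (4 : ℝ) * (2 * E) * (q * T * (2 * F)) ≤
        4 * (2 * E) * (q * T * (2 * (8 * (n + 1) * B))) := by
      have := hF n
      gcongr
    rw [div_le_iff₀ (by positivity)]
    have h4 : 128 * q * T * B / κ ^ 2 * E * (n + 1) =
      4 * (2 * E) * (q * T * (2 * (8 * (n + 1) * B))) / κ ^ 2 := by ring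
    rw [h4, le_div_iff₀ (by positivity)]
    calc α n ^ 2 * κ ^ 2 = (κ * α n) ^ 2 := by ring
      _ ≤ _ := h2.trans h3
  have hsum : ∀ N, ∑ n ∈ Finset.range (N + 1), α n ^ 2 / (n + 1) ≤
      (128 * q * T * B / κ ^ 2 * B) * α N := by
    intro N
    refine (Finset.sum_le_sum fun n _ => hsq n).trans ?_
    rw [← Finset.mul_sum, mul_assoc _ B (α N)]
    exact mul_le_mul_of_nonneg_left (hbd N) (by positivity)
  have hzero := eq_zero_of_sum_sq_div_le hα0 hsum n
  by_cases hx : x ∈ box d n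
  · exact (Finset.sum_eq_zero_iff_of_nonneg fun x _ => hA0 n x).1 hzero x hx
  · simp [hA, boxDissipation, hx]

/-- The dissipation is continuous and nonnegative in time with zero integral, so it already vanishes
at time 0. -/
theorem mass_box_eq (hd : d = 1 ∨ d = 2)
    (h : IsPeriodicFlow hc T ℓ) (h' : IsPeriodicFlow hc T' ℓ')
    (hstat : ∀ Λ f, ℓ' 0 (cylGen hc Λ f) = 0) {w : Site d → Fin q → Fin q → ℝ}
    (hw : ∀ (Λ : Finset (Site d)) σ (x : Λ) i,
      mass (ℓ' 0) Λ σ = w x (σ x) i * mass (ℓ' 0) Λ (Function.update σ x i))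
    (n : ℕ) : mass (ℓ 0) (box d n) = mass (ℓ' 0) (box d n) := by
  have hm : ∀ σ, 0 < mass (ℓ' 0) (box d n) σ := fun σ => h'.mass_pos _ σ le_rfl
  refine eq_of_dissipation_eq_zero (fun σ => h.mass_pos _ σ le_rfl) hm (h.sum_mass 0 _)
    (h'.sum_mass 0 _) fun x => ?_
  have h0 := h.boxDissipation_eq_zero hd h' hstat hw n x
  rw [boxDissipation, dif_pos x.2] at h0
  have hnn : ∀ s, 0 ≤ s → 0 ≤ dissipation (mass (ℓ s) (box d n)) (mass (ℓ' 0) (box d n)) x :=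
    fun s hs => dissipation_nonneg (fun σ => h.mass_pos _ σ hs) hm x
  by_contra hne
  refine absurd h0 (ne_of_gt ?_)
  exact intervalIntegral.integral_pos h.pos
    ((h.continuousOn_dissipation hm x).mono fun s hs => hs.1) (fun s hs => hnn s hs.1.le)
    ⟨0, ⟨le_rfl, h.pos.le⟩, lt_of_le_of_ne (hnn 0 le_rfl) (Ne.symm hne)⟩

end IsPeriodicFlow

end Uniqueness

/-! ### Evolution of measures -/

section Evolution

variable {d q : ℕ} {c : Rates d q}

theorem integrable_continuousMap (ν : ProbabilityMeasure (Config d q)) (f : C(Config d q, ℝ)) :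
    Integrable f (ν : Measure (Config d q)) :=
  f.continuous.integrable_of_hasCompactSupport (HasCompactSupport.of_compactSpace f)

/-- Integration against a probability measure as a continuous functional. -/
noncomputable def mean (ν : ProbabilityMeasure (Config d q)) : C(Config d q, ℝ) →L[ℝ] ℝ :=
  LinearMap.mkContinuous
    { toFun := fun f => ∫ η, f η ∂(ν : Measure (Config d q))
      map_add' := fun f g =>
        integral_add (integrable_continuousMap ν f) (integrable_continuousMap ν g)
      map_smul' := fun r f => integral_const_mul r _ } 1 fun f => by
    have := norm_integral_le_of_norm_le_const (μ := (ν : Measure (Config d q)))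
      (Eventually.of_forall f.norm_coe_le_norm)
    simpa using this

theorem mean_apply (ν : ProbabilityMeasure (Config d q)) (f : C(Config d q, ℝ)) :
    mean ν f = ∫ η, f η ∂(ν : Measure (Config d q)) := rfl

theorem mass_mean (ν : ProbabilityMeasure (Config d q)) (Λ : Finset (Site d)) (σ : Λ → Fin q) :
    mass (mean ν) Λ σ = ((ν : Measure (Config d q)).map Λ.restrict).real {σ} := by
  have h1 : ∫ η, (Pi.single σ 1 : (Λ → Fin q) → ℝ) (Λ.restrict η) ∂(ν : Measure (Config d q)) =
      ∫ τ, (Pi.single σ 1 : (Λ → Fin q) → ℝ) τ ∂((ν : Measure (Config d q)).map Λ.restrict) :=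
    (integral_map Λ.measurable_restrict.aemeasurable
      (measurable_of_finite _).aestronglyMeasurable).symm
  have h2 : (Pi.single σ 1 : (Λ → Fin q) → ℝ) = Set.indicator {σ} 1 := by
    ext τ
    simp [Pi.single_apply, Set.indicator_apply]
  rw [mass, mean_apply]
  refine h1.trans ?_
  rw [h2, integral_indicator_one (measurableSet_singleton σ)]

/-- Every finite set of sites lies in a box, and a measure is determined by its finite-dimensional
marginals. -/
theorem eq_of_mass_box_eq {ν μ : ProbabilityMeasure (Config d q)}
    (h : ∀ n, mass (mean ν) (box d n) = mass (mean μ) (box d n)) : ν = μ := by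
  have hbox : ∀ n, (ν : Measure (Config d q)).map (box d n).restrict =
      (μ : Measure (Config d q)).map (box d n).restrict := by
    intro n
    have := Measure.isProbabilityMeasure_map (μ := (ν : Measure (Config d q)))
      (box d n).measurable_restrict.aemeasurable
    have := Measure.isProbabilityMeasure_map (μ := (μ : Measure (Config d q)))
      (box d n).measurable_restrict.aemeasurable
    refine Measure.ext_of_singleton fun σ => ?_
    have h1 := congrFun (h n) σ
    rw [mass_mean, mass_mean] at h1
    exact (measureReal_eq_measureReal_iff).1 h1
  have hall : ∀ J : Finset (Site d), (ν : Measure (Config d q)).map J.restrict =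
      (μ : Measure (Config d q)).map J.restrict := by
    intro J
    have hJ : J ⊆ box d (J.sup supNorm) := fun x hx => mem_box.2 (Finset.le_sup hx)
    rw [← Finset.restrict₂_comp_restrict hJ, ← Measure.map_map (Finset.measurable_restrict₂ hJ)
      (Finset.measurable_restrict _), hbox, Measure.map_map (Finset.measurable_restrict₂ hJ)
      (Finset.measurable_restrict _)]
  have hfin : ∀ J : Finset (Site d), IsFiniteMeasure ((μ : Measure (Config d q)).map J.restrict) :=
    fun J => inferInstance
  exact Subtype.ext (IsProjectiveLimit.unique
    (P := fun J => (μ : Measure (Config d q)).map J.restrict) hall fun J => rfl)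

theorem mass_mean_of_eq_infinitePi {μ : ProbabilityMeasure (Config d q)}
    {m : Site d → ProbabilityMeasure (Fin q)}
    (hμ : (μ : Measure (Config d q)) = Measure.infinitePi fun x => (m x : Measure (Fin q)))
    (Λ : Finset (Site d)) (σ : Λ → Fin q) :
    mass (mean μ) Λ σ = ∏ x : Λ, (m x : Measure (Fin q)).real {σ x} := by
  rw [mass_mean, hμ, Measure.infinitePi_map_restrict, measureReal_def, Measure.pi_singleton,
    ENNReal.toReal_prod]
  rfl

/-- All factors of the product except the one at `x` cancel. Positivity of the masses rules out a
zero denominator. -/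
theorem mass_mean_update_of_eq_infinitePi {μ : ProbabilityMeasure (Config d q)}
    {m : Site d → ProbabilityMeasure (Fin q)}
    (hμ : (μ : Measure (Config d q)) = Measure.infinitePi fun x => (m x : Measure (Fin q)))
    (hpos : ∀ Λ σ, 0 < mass (mean μ) Λ σ) (Λ : Finset (Site d)) (σ : Λ → Fin q) (x : Λ)
    (i : Fin q) : mass (mean μ) Λ σ =
      (m x : Measure (Fin q)).real {σ x} / (m x : Measure (Fin q)).real {i} *
        mass (mean μ) Λ (Function.update σ x i) := by
  have h1 := (hpos Λ (Function.update σ x i)).ne'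
  rw [mass_mean_of_eq_infinitePi hμ, Finset.prod_ne_zero_iff] at h1
  have h2 := h1 x (Finset.mem_univ _)
  rw [Function.update_self] at h2
  rw [mass_mean_of_eq_infinitePi hμ, mass_mean_of_eq_infinitePi hμ,
    ← Finset.mul_prod_erase _ _ (Finset.mem_univ x),
    ← Finset.mul_prod_erase (Finset.univ : Finset Λ)
      (fun y : Λ => (m y : Measure (Fin q)).real {Function.update σ x i y}) (Finset.mem_univ x),
    Function.update_self, ← mul_assoc, div_mul_cancel₀ _ h2]
  congr 1
  refine Finset.prod_congr rfl fun y hy => ?_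
  rw [Function.update_of_ne (Finset.ne_of_mem_erase hy)]

variable {P : ℝ≥0 → C(Config d q, ℝ) →L[ℝ] C(Config d q, ℝ)}

/-- The law at time `s` of the process started from `ν`, as a functional. -/
noncomputable def evolution (P : ℝ≥0 → C(Config d q, ℝ) →L[ℝ] C(Config d q, ℝ))
    (ν : ProbabilityMeasure (Config d q)) (s : ℝ) : C(Config d q, ℝ) →L[ℝ] ℝ :=
  (mean ν).comp (P s.toNNReal)

theorem evolution_apply (ν : ProbabilityMeasure (Config d q)) (s : ℝ) (f : C(Config d q, ℝ)) :
    evolution P ν s f = mean ν (P s.toNNReal f) := rfl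

theorem evolution_zero (hP : IsMarkovSemigroup P) (ν : ProbabilityMeasure (Config d q)) :
    evolution P ν 0 = mean ν := by
  ext f
  rw [evolution_apply, Real.toNNReal_zero, hP.zero]

/-- The forward equation: by the semigroup property the difference quotient at `s` is the one at 0
with the law at time `s` applied to it, and this law is a continuous functional. -/
theorem hasDerivWithinAt_evolution (hP : IsMarkovSemigroup P)
    (ν : ProbabilityMeasure (Config d q)) {f g : C(Config d q, ℝ)}
    (hfg : (f, g) ∈ generatorGraph P) {s : ℝ} (hs : 0 ≤ s) :
    HasDerivWithinAt (fun s => evolution P ν s f) (evolution P ν s g) (Set.Ioi s) s := by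
  rw [hasDerivWithinAt_iff_tendsto_slope' (by simp)]
  have hshift : Tendsto (fun r : ℝ => (r - s).toNNReal) (𝓝[>] s) (𝓝[>] 0) := by
    refine tendsto_nhdsWithin_iff.2 ⟨?_, ?_⟩
    · have : Continuous fun r : ℝ => (r - s).toNNReal := by fun_prop
      have h1 := (this.tendsto s).mono_left (nhdsWithin_le_nhds (s := Set.Ioi s))
      simpa using h1
    · filter_upwards [self_mem_nhdsWithin] with r hr
      simpa using hr
  have hlim := ((evolution P ν s).continuous.tendsto g).comp (Tendsto.comp hfg hshift)
  refine hlim.congr' ?_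
  filter_upwards [self_mem_nhdsWithin] with r hr
  have hr' : 0 ≤ r - s := sub_nonneg.2 (le_of_lt hr)
  have h1 : r.toNNReal = s.toNNReal + (r - s).toNNReal := by
    rw [← Real.toNNReal_add hs hr', add_sub_cancel]
  simp only [Function.comp, map_smul, map_sub, slope, vsub_eq_sub, smul_eq_mul]
  rw [Real.coe_toNNReal _ hr', evolution_apply ν r, h1, hP.add]
  rfl

theorem isPeriodicFlow_evolution (hc : RateConditions c) (hP : IsSemigroupOf c P)
    {ν : ProbabilityMeasure (Config d q)} {T : ℝ≥0} (hT : 0 < T) (hν : IsEvolved P T ν ν) :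
    IsPeriodicFlow hc T (evolution P ν) where
  pos := hT
  nonneg s f hf := integral_nonneg (hP.markov.nonneg _ f hf)
  one s := by
    rw [evolution_apply, hP.markov.one, mean_apply]
    simp
  continuous f := (mean ν).continuous.comp
    ((hP.markov.continuous f).comp continuous_real_toNNReal)
  deriv s hs Λ f := by
    refine hasDerivWithinAt_evolution hP.markov ν ?_ hs
    rw [hP.generator_eq]
    exact subset_closure (cylFun_mem_pregeneratorGraph hc Λ f)
  periodic s hs := by
    ext f
    have hT' : (0 : ℝ) ≤ T := T.2
    rw [evolution_apply, evolution_apply, Real.toNNReal_add hs hT', Real.toNNReal_coe, add_comm,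
      hP.markov.add]
    exact (hν _).symm

/-- A constant function of time has derivative zero; the period 1 is an arbitrary choice. -/
theorem mean_cylGen_eq_zero (hc : RateConditions c) (hP : IsSemigroupOf c P)
    {μ : ProbabilityMeasure (Config d q)} (hμ : μ ∈ stationaryMeasures P) (Λ : Finset (Site d))
    (f : (Λ → Fin q) → ℝ) : evolution P μ 0 (cylGen hc Λ f) = 0 := by
  have h1 := (isPeriodicFlow_evolution hc hP one_pos (hμ 1)).deriv 0 le_rfl Λ f
  have h2 : (fun s => evolution P μ s (cylFun Λ f)) = fun _ => mean μ (cylFun Λ f) := by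
    ext s
    exact (hμ s.toNNReal (cylFun Λ f)).symm
  rw [h2] at h1
  exact (uniqueDiffWithinAt_Ioi 0).eq_deriv _ h1 (hasDerivWithinAt_const _ _ _)

theorem eq_of_mem_periodicMeasures (hd : d = 1 ∨ d = 2) (hc : RateConditions c)
    (hP : IsSemigroupOf c P) {μ ν : ProbabilityMeasure (Config d q)}
    (hprod : IsProductMeasure μ) (hμ : μ ∈ stationaryMeasures P) (hν : ν ∈ periodicMeasures P) :
    ν = μ := by
  obtain ⟨T, hT, hνT⟩ := hν
  obtain ⟨m, hm⟩ := hprod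
  have h := isPeriodicFlow_evolution hc hP hT hνT
  -- The stationary measure is itself treated as a periodic flow, which yields positivity of its
  -- cylinder masses.
  have h' := isPeriodicFlow_evolution hc hP one_pos (hμ 1)
  have hpos : ∀ Λ σ, 0 < mass (mean μ) Λ σ := fun Λ σ => by
    rw [← evolution_zero hP.markov]
    exact h'.mass_pos Λ σ le_rfl
  refine eq_of_mass_box_eq fun n => ?_
  have := h.mass_box_eq hd h' (mean_cylGen_eq_zero hc hP hμ)
    (w := fun x a i => (m x : Measure (Fin q)).real {a} / (m x : Measure (Fin q)).real {i})
    (fun Λ σ x i => by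
      rw [evolution_zero hP.markov]
      exact mass_mean_update_of_eq_infinitePi hm hpos Λ σ x i) n
  rwa [evolution_zero hP.markov, evolution_zero hP.markov] at this

end Evolution

end IPS

theorem theorem1 (d q : ℕ) (hd : d = 1 ∨ d = 2) (c : IPS.Rates d q)
    (hc : IPS.RateConditions c)
    (P : ℝ≥0 → C(IPS.Config d q, ℝ) →L[ℝ] C(IPS.Config d q, ℝ))
    (hP : IPS.IsSemigroupOf c P)
    (μ : ProbabilityMeasure (IPS.Config d q))
    (hμ_prod : IPS.IsProductMeasure μ) (hμ_stat : μ ∈ IPS.stationaryMeasures P) :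
    IPS.periodicMeasures P = IPS.stationaryMeasures P ∧ IPS.stationaryMeasures P = {μ} := by
  have h1 : IPS.stationaryMeasures P ⊆ IPS.periodicMeasures P := fun ν hν =>
    ⟨1, one_pos, hν 1⟩
  have h2 : IPS.periodicMeasures P ⊆ {μ} := fun ν hν =>
    IPS.eq_of_mem_periodicMeasures hd hc hP hμ_prod hμ_stat hν
  have h3 : {μ} ⊆ IPS.stationaryMeasures P := Set.singleton_subset_iff.2 hμ_stat
  exact ⟨(h2.trans h3).antisymm h1, (h1.trans h2).antisymm h3⟩
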